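/- Let $\mathcal S\subset\mathbb C$ be a finite nonempty constellation, and let $P_1,P_2,W>0$. For $\alpha\in(0,1)$ put $W_1=\alpha W$, $W_2=(1-\alpha)W$. Both users use the same constellation $\mathcal S_1=\mathcal S_2=\mathcal S$: let $X_1,X_2$ be uniformly distributed on $\mathcal S$, let $N_i\sim\mathcal{CN}(0,W_i)$ be circularly symmetric complex Gaussian noise of mean $0$ and variance $W_i$ ($i=1,2$), with $X_1,X_2,N_1,N_2$ independent, and let $$Y_1=\sqrt{P_1}\,X_1+N_1,\qquad Y_2=\sqrt{P_2}\,X_2+N_2 .$$ The FDMA sum rate, in bits per second, is $$R(\alpha)=\alpha W\, I\bigl(\sqrt{P_1}X_1;Y_1\,\big|\,\sqrt{P_2}X_2\bigr)+(1-\alpha)W\, I\bigl(\sqrt{P_2}X_2;Y_2\,\big|\,\sqrt{P_1}X_1\bigr),$$ where $I(\cdot\,;\cdot\,|\,\cdot)$ is conditional mutual information in bits. Then $R$ attains a finite maximum over $\alpha\in(0,1)$ at $$\alpha=\frac{P_1}{P_1+P_2},$$ and if $\mathcal S$ has at least two points, this is the only maximizer. (For a one-point constellation $R\equiv0$.) 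-/

import Mathlib

open MeasureTheory ProbabilityTheory
open scoped ENNReal

noncomputable section

namespace FDMA

/-- The mutual information in bits of a pair `(X, Y)` with joint law `ρ`: the Kullback-Leibler
divergence of the joint law from the product of its marginals, divided by `log 2` because `klDiv`
uses the natural logarithm. -/
def mutualInfo {A B : Type*} [MeasurableSpace A] [MeasurableSpace B]
    (ρ : Measure (A × B)) : ℝ≥0∞ :=
  InformationTheory.klDiv ρ ((ρ.map Prod.fst).prod (ρ.map Prod.snd)) / ENNReal.ofReal (Real.log 2)

/-- The conditional mutual information `I(X; Y | Z)` in bits: the mutual information of the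
regular conditional law of `(X, Y)` given `Z = z`, averaged over the law of `Z`. -/
def condMutualInfo {Ω A B C : Type*} [MeasurableSpace Ω]
    [MeasurableSpace A] [StandardBorelSpace A] [Nonempty A]
    [MeasurableSpace B] [StandardBorelSpace B] [Nonempty B] [MeasurableSpace C]
    (X : Ω → A) (Y : Ω → B) (Z : Ω → C) (μ : Measure Ω) [IsFiniteMeasure μ] : ℝ≥0∞ :=
  ∫⁻ z, mutualInfo (condDistrib (fun ω => (X ω, Y ω)) Z μ z) ∂(μ.map Z)

/-- The circularly symmetric complex Gaussian law of mean zero and variance `v ≥ 0`: the real and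
the imaginary part are independent real Gaussians of mean zero and variance `v / 2`. -/
def complexGaussian (v : ℝ) : Measure ℂ :=
  ((gaussianReal 0 (v / 2).toNNReal).prod (gaussianReal 0 (v / 2).toNNReal)).map
    Complex.measurableEquivRealProd.symm

instance (v : ℝ) : IsProbabilityMeasure (complexGaussian v) :=
  Measure.isProbabilityMeasure_map Complex.measurableEquivRealProd.symm.measurable.aemeasurable

/-- The joint law of `(X₁, X₂, N₁, N₂)` on `ℂ × ℂ × ℂ × ℂ`: the four are independent, the symbol
`Xᵢ` is uniform on the constellation `Sᵢ`, and the noise `Nᵢ` is complex Gaussian of variance equal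
to the width `Wᵢ` of the sub-band. -/
def channelLaw (S₁ S₂ : Finset ℂ) (W₁ W₂ : ℝ) : Measure (ℂ × ℂ × ℂ × ℂ) :=
  (uniformOn (S₁ : Set ℂ)).prod
    ((uniformOn (S₂ : Set ℂ)).prod ((complexGaussian W₁).prod (complexGaussian W₂)))

instance (S : Finset ℂ) : IsFiniteMeasure (uniformOn (S : Set ℂ)) := by
  unfold uniformOn; infer_instance

instance (S₁ S₂ : Finset ℂ) (W₁ W₂ : ℝ) : IsFiniteMeasure (channelLaw S₁ S₂ W₁ W₂) := by
  unfold channelLaw; infer_instance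

/-- The transmitted signal `√P₁ X₁` of user 1. -/
def sent₁ (P₁ : ℝ) (ω : ℂ × ℂ × ℂ × ℂ) : ℂ := (Real.sqrt P₁ : ℂ) * ω.1

/-- The transmitted signal `√P₂ X₂` of user 2. -/
def sent₂ (P₂ : ℝ) (ω : ℂ × ℂ × ℂ × ℂ) : ℂ := (Real.sqrt P₂ : ℂ) * ω.2.1

/-- The signal `Y₁ = √P₁ X₁ + N₁` at receiver 1 (no interference under FDMA). -/
def received₁ (P₁ : ℝ) (ω : ℂ × ℂ × ℂ × ℂ) : ℂ := sent₁ P₁ ω + ω.2.2.1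

/-- The signal `Y₂ = √P₂ X₂ + N₂` at receiver 2 (no interference under FDMA). -/
def received₂ (P₂ : ℝ) (ω : ℂ × ℂ × ℂ × ℂ) : ℂ := sent₂ P₂ ω + ω.2.2.2

/-- The FDMA sum rate `W₁ I(√P₁ X₁; Y₁ | √P₂ X₂) + W₂ I(√P₂ X₂; Y₂ | √P₁ X₁)` in bits per second,
where `W₁ = α W` and `W₂ = (1 - α) W`. -/
def sumRate (S₁ S₂ : Finset ℂ) (P₁ P₂ W α : ℝ) : ℝ≥0∞ :=
  ENNReal.ofReal (α * W) *
      condMutualInfo (sent₁ P₁) (received₁ P₁) (sent₂ P₂)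
        (channelLaw S₁ S₂ (α * W) ((1 - α) * W)) +
    ENNReal.ofReal ((1 - α) * W) *
      condMutualInfo (sent₂ P₂) (received₂ P₂) (sent₁ P₁)
        (channelLaw S₁ S₂ (α * W) ((1 - α) * W))

end FDMA

end

-- Complex Gaussian laws: sums, scalings, shifts, integrability

namespace FDMA

-- Let g(u) be the mutual information in nats of a uniform symbol and its Gaussian observation at
-- signal-to-noise ratio u (`gaussianInfo`). Independence removes the conditioning, so up to the
-- factor 1/log 2 the sum rate is W(α g(P₁/(αW)) + (1-α) g(P₂/((1-α)W))) (`sumRate_eq`). The mean of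
-- the two ratios with weights α, 1-α is always (P₁+P₂)/W. If g is strictly concave, Jensen bounds
-- the rate by W g((P₁+P₂)/W), with equality only when the ratios agree, that is, for the
-- proportional split (`natRate_lt`).
--
-- Strict concavity of g is proved without derivatives. Normalize the observation at ratio u to a =
-- ux + noise of variance u. This has independent increments given x: if A, B, C are conditionally
-- independent observations at ratios u, t, t, then A+B, A+C and A+B+C are sufficient observations
-- at ratios u+t, u+t and u+2t. Hence 2g(u+t) - g(u) - g(u+2t) = I(B;C|A), the divergence of the law
-- of (A,B,C) from its Markov version p(a,b)p(a,c)/p(a). Written against the product of centred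
-- Gaussians, it is the integral of a continuous nonnegative function, `subadditivityGap`, which is
-- nonzero somewhere by strict Cauchy-Schwarz when there are two symbols. This is
-- `gaussianInfo_midpoint`; with continuity of g it gives strict concavity.

instance isGaussian_complexGaussian (v : ℝ) : IsGaussian (complexGaussian v) :=
  -- The same map is a continuous linear equivalence, and these preserve Gaussian measures.
  inferInstanceAs (IsGaussian (((gaussianReal 0 (v / 2).toNNReal).prod
    (gaussianReal 0 (v / 2).toNNReal)).map Complex.equivRealProdCLM.symm))

lemma charFun_complexGaussian {v : ℝ} (hv : 0 ≤ v) (t : ℂ) :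
    charFun (complexGaussian v) t = Complex.exp (-(v * ‖t‖ ^ 2 / 4 : ℝ)) := by
  have key : charFun (complexGaussian v) t =
      charFun (gaussianReal 0 (v / 2).toNNReal) t.re *
        charFun (gaussianReal 0 (v / 2).toNNReal) t.im := by
    simp_rw [charFun, complexGaussian, ← integral_prod_mul, integral_map_equiv]
    congr 1 with p
    rw [← Complex.exp_add]
    congr 1
    simp [Complex.inner, Complex.measurableEquivRealProd]
    ring
  rw [key, charFun_gaussianReal, charFun_gaussianReal, ← Complex.exp_add]
  congr 1
  rw [Complex.sq_norm, Complex.normSq_apply]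
  have : ((v / 2).toNNReal : ℝ) = v / 2 := Real.coe_toNNReal _ (by positivity)
  have h2 : (((v / 2).toNNReal : ℝ) : ℂ) = (v / 2 : ℝ) := by rw [this]
  rw [h2]
  push_cast
  ring

lemma complexGaussian_add {u v : ℝ} (hu : 0 ≤ u) (hv : 0 ≤ v) :
    ((complexGaussian u).prod (complexGaussian v)).map (fun p => p.1 + p.2) =
      complexGaussian (u + v) := by
  have : IsProbabilityMeasure
      (((complexGaussian u).prod (complexGaussian v)).map (fun p => p.1 + p.2)) :=
    Measure.isProbabilityMeasure_map (by fun_prop)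
  apply Measure.ext_of_charFun
  rw [charFun_map_add_prod_eq_mul]
  ext t
  rw [Pi.mul_apply, charFun_complexGaussian hu, charFun_complexGaussian hv,
    charFun_complexGaussian (by positivity), ← Complex.exp_add]
  congr 1
  push_cast
  ring

lemma complexGaussian_map_mul (c : ℝ) {v : ℝ} (hv : 0 ≤ v) :
    (complexGaussian v).map (fun z => (c : ℂ) * z) = complexGaussian (c ^ 2 * v) := by
  have : IsProbabilityMeasure ((complexGaussian v).map (fun z => (c : ℂ) * z)) :=
    Measure.isProbabilityMeasure_map (by fun_prop)
  apply Measure.ext_of_charFun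
  ext t
  have : (fun z : ℂ => (c : ℂ) * z) = fun z => c • z := by ext z; simp
  rw [this, charFun_map_smul, charFun_complexGaussian hv,
    charFun_complexGaussian (by positivity), norm_smul, mul_pow, Real.norm_eq_abs, sq_abs]
  congr 3
  ring

lemma complexGaussian_eq_withDensity {v : ℝ} (hv : 0 < v) :
    complexGaussian v = (volume : Measure ℂ).withDensity
      (fun z => ENNReal.ofReal ((Real.pi * v)⁻¹ * Real.exp (-‖z‖ ^ 2 / v))) := by
  have h0 : (v / 2).toNNReal ≠ 0 := by simpa using hv
  have hc : ((v / 2).toNNReal : ℝ) = v / 2 := Real.coe_toNNReal _ (by positivity)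
  have hvol : (volume : Measure ℂ) = ((volume : Measure ℝ).prod (volume : Measure ℝ)).map
      Complex.measurableEquivRealProd.symm :=
    Complex.volume_preserving_equiv_real_prod.symm.map_eq.symm
  rw [complexGaussian, gaussianReal_of_var_ne_zero _ h0,
    prod_withDensity (measurable_gaussianPDF _ _) (measurable_gaussianPDF _ _), hvol]
  ext s hs
  rw [Measure.map_apply (by fun_prop) hs, withDensity_apply _ (by measurability),
    withDensity_apply _ hs, setLIntegral_map hs (by fun_prop) (by fun_prop)]
  congr 1 with p
  rw [gaussianPDF, gaussianPDF, ← ENNReal.ofReal_mul (gaussianPDFReal_nonneg _ _ _)]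
  congr 1
  simp only [gaussianPDFReal, hc, Complex.measurableEquivRealProd_symm_apply, sub_zero]
  rw [Complex.sq_norm, Complex.normSq_apply]
  have hs : (√(2 * Real.pi * (v / 2)))⁻¹ * (√(2 * Real.pi * (v / 2)))⁻¹ = (Real.pi * v)⁻¹ := by
    rw [← mul_inv, Real.mul_self_sqrt (by positivity)]
    congr 1; ring
  rw [mul_mul_mul_comm, hs, ← Real.exp_add]
  congr 2
  field_simp
  ring

lemma isOpenPosMeasure_complexGaussian {v : ℝ} (hv : 0 < v) :
    (complexGaussian v).IsOpenPosMeasure := by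
  rw [complexGaussian_eq_withDensity hv]
  refine (withDensity_absolutelyContinuous' (by fun_prop)
    (ae_of_all _ fun z => ?_)).isOpenPosMeasure
  simp only [ne_eq, ENNReal.ofReal_eq_zero, not_le]
  positivity

/-- The Cameron-Martin formula, from expanding ‖m + z‖² and translation invariance of Lebesgue
measure. -/
lemma complexGaussian_map_const_add {v : ℝ} (hv : 0 < v) (m : ℂ) :
    (complexGaussian v).map (fun z => m + z) = (complexGaussian v).withDensity
      (fun z => ENNReal.ofReal (Real.exp ((2 * inner ℝ m z - ‖m‖ ^ 2) / v))) := by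
  have hm : Measure.map (fun z => m + z) (volume : Measure ℂ) = volume :=
    (measurePreserving_add_left volume m).map_eq
  rw [complexGaussian_eq_withDensity hv, ← withDensity_mul _ (by fun_prop) (by fun_prop)]
  ext s hs
  rw [Measure.map_apply (by fun_prop) hs, withDensity_apply _ ((by fun_prop :
    Measurable fun z : ℂ => m + z) hs), withDensity_apply _ hs]
  conv_rhs => rw [← hm]
  rw [setLIntegral_map hs (by fun_prop) (by fun_prop)]
  congr 1 with z
  rw [Pi.mul_apply, ← ENNReal.ofReal_mul (by positivity), mul_assoc, ← Real.exp_add]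
  congr 3
  rw [norm_add_sq_real, inner_add_right, real_inner_self_eq_norm_sq]
  field_simp
  ring

/-- Fernique's theorem makes exp(C‖x‖²) integrable for some C > 0, and completing the square gives
c‖x‖ ≤ c²/(4C) + C‖x‖². -/
lemma integrable_exp_norm {E : Type*} [NormedAddCommGroup E] [NormedSpace ℝ E]
    [MeasurableSpace E] [BorelSpace E] [SecondCountableTopology E] [CompleteSpace E]
    (μ : Measure E) [IsGaussian μ] (c : ℝ) :
    Integrable (fun x => Real.exp (c * ‖x‖)) μ := by
  obtain ⟨C, hC, hint⟩ := IsGaussian.exists_integrable_exp_sq μ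
  refine (hint.const_mul (Real.exp (c ^ 2 / (4 * C)))).mono' (by fun_prop) (ae_of_all _ fun x => ?_)
  rw [Real.norm_of_nonneg (Real.exp_pos _).le, ← Real.exp_add]
  refine Real.exp_le_exp.2 ?_
  have : c ^ 2 / (4 * C) + C * ‖x‖ ^ 2 - c * ‖x‖ = C * (‖x‖ - c / (2 * C)) ^ 2 := by
    field_simp
    ring
  nlinarith [mul_nonneg hC.le (sq_nonneg (‖x‖ - c / (2 * C)))]

/-- A continuous function of at most exponential growth is integrable for a Gaussian measure. -/
lemma integrable_of_exp_growth {E : Type*} [NormedAddCommGroup E] [NormedSpace ℝ E]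
    [MeasurableSpace E] [BorelSpace E] [SecondCountableTopology E] [CompleteSpace E]
    (μ : Measure E) [IsGaussian μ] {f : E → ℝ} (hf : Continuous f) {c K : ℝ}
    (h : ∀ x, |f x| ≤ K * Real.exp (c * ‖x‖)) : Integrable f μ :=
  ((integrable_exp_norm μ c).const_mul K).mono' hf.aestronglyMeasurable (ae_of_all _ h)

end FDMA

-- Exponential growth bounds, likelihoods and mixtures

noncomputable section

namespace FDMA

/-- A family of functions with a common bound of exponential growth. -/
def ExpBounded {T E : Type*} [NormedAddCommGroup E] (f : T → E → ℝ) : Prop :=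
  ∃ c K : ℝ, 0 ≤ c ∧ 0 ≤ K ∧ ∀ t x, |f t x| ≤ K * Real.exp (c * ‖x‖)

namespace ExpBounded

variable {T E : Type*} [NormedAddCommGroup E] {f g : T → E → ℝ}

lemma mono (hg : ExpBounded g) (h : ∀ t x, |f t x| ≤ |g t x|) : ExpBounded f := by
  obtain ⟨c, K, hc, hK, hb⟩ := hg
  exact ⟨c, K, hc, hK, fun t x => (h t x).trans (hb t x)⟩

lemma add (hf : ExpBounded f) (hg : ExpBounded g) : ExpBounded fun t x => f t x + g t x := by
  obtain ⟨c, K, hc, hK, hb⟩ := hf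
  obtain ⟨d, M, hd, hM, hb'⟩ := hg
  refine ⟨c + d, K + M, by positivity, by positivity, fun t x => ?_⟩
  calc |f t x + g t x| ≤ |f t x| + |g t x| := abs_add_le _ _
    _ ≤ K * Real.exp (c * ‖x‖) + M * Real.exp (d * ‖x‖) := add_le_add (hb t x) (hb' t x)
    _ ≤ K * Real.exp ((c + d) * ‖x‖) + M * Real.exp ((c + d) * ‖x‖) := by
        gcongr <;> linarith
    _ = _ := by ring

lemma mul (hf : ExpBounded f) (hg : ExpBounded g) : ExpBounded fun t x => f t x * g t x := by
  obtain ⟨c, K, hc, hK, hb⟩ := hf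
  obtain ⟨d, M, hd, hM, hb'⟩ := hg
  refine ⟨c + d, K * M, by positivity, by positivity, fun t x => ?_⟩
  calc |f t x * g t x| = |f t x| * |g t x| := abs_mul _ _
    _ ≤ (K * Real.exp (c * ‖x‖)) * (M * Real.exp (d * ‖x‖)) :=
        mul_le_mul (hb t x) (hb' t x) (abs_nonneg _) (by positivity)
    _ = _ := by rw [add_mul, Real.exp_add]; ring

lemma const (r : ℝ) : ExpBounded (fun (_ : T) (_ : E) => r) :=
  ⟨0, |r|, le_rfl, abs_nonneg _, fun _ _ => by simp⟩

lemma sub (hf : ExpBounded f) (hg : ExpBounded g) : ExpBounded fun t x => f t x - g t x :=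
  (hf.add ((const (-1)).mul hg)).mono fun t x => by rw [neg_one_mul, ← sub_eq_add_neg]

lemma sum {ι : Type*} (s : Finset ι) {h : ι → T → E → ℝ} (hh : ∀ i ∈ s, ExpBounded (h i)) :
    ExpBounded fun t x => ∑ i ∈ s, h i t x := by
  classical
  induction s using Finset.induction_on with
  | empty => simpa using const 0
  | insert i s his ih =>
    simp_rw [Finset.sum_insert his]
    exact (hh i (Finset.mem_insert_self i s)).add
      (ih fun j hj => hh j (Finset.mem_insert_of_mem hj))

/-- From log r ≤ r - 1 at r = f and r = 1/f, |log f| ≤ f + 1/f. This is why reciprocals are bounded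
alongside the functions below. -/
lemma log (hf : ExpBounded f) (hf' : ExpBounded fun t x => (f t x)⁻¹) (hpos : ∀ t x, 0 < f t x) :
    ExpBounded fun t x => Real.log (f t x) := by
  refine (hf.add hf').mono fun t x => ?_
  have h := hpos t x
  have h' := inv_pos.2 h
  rw [abs_of_pos (add_pos h h'), abs_le]
  have h1 := Real.log_le_sub_one_of_pos h
  have h2 := Real.log_le_sub_one_of_pos h'
  rw [Real.log_inv] at h2
  constructor <;> linarith

lemma integrable {E : Type*} [NormedAddCommGroup E] [NormedSpace ℝ E]
    [MeasurableSpace E] [BorelSpace E] [SecondCountableTopology E] [CompleteSpace E]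
    {f : T → E → ℝ} (hf : ExpBounded f) (t : T) (hc : Continuous (f t)) (μ : Measure E)
    [IsGaussian μ] : Integrable (f t) μ := by
  obtain ⟨c, K, -, -, hb⟩ := hf
  exact integrable_of_exp_growth μ hc (hb t)

end ExpBounded

/-- The density at `a` of the Gaussian law of mean `u x` and variance `u` with respect to the
centred one. -/
def likelihood (x : ℂ) (u : ℝ) (a : ℂ) : ℝ := Real.exp (2 * inner ℝ x a - u * ‖x‖ ^ 2)

/-- The average of `likelihood x u a` over the constellation. -/
def mixture (S : Finset ℂ) (u : ℝ) (a : ℂ) : ℝ := (S.card : ℝ)⁻¹ * ∑ x ∈ S, likelihood x u a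

/-- The mutual information in nats between a uniform symbol of `S` and its observation in complex
Gaussian noise, at signal-to-noise ratio `u`. -/
def gaussianInfo (S : Finset ℂ) (u : ℝ) : ℝ :=
  (S.card : ℝ)⁻¹ * ∑ x ∈ S, ∫ a, likelihood x u a *
    (Real.log (likelihood x u a) - Real.log (mixture S u a)) ∂(complexGaussian u)

variable {S : Finset ℂ}

lemma likelihood_pos (x : ℂ) (u : ℝ) (a : ℂ) : 0 < likelihood x u a := Real.exp_pos _

lemma mixture_pos (hS : S.Nonempty) (u : ℝ) (a : ℂ) : 0 < mixture S u a := by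
  have : 0 < (S.card : ℝ) := by exact_mod_cast hS.card_pos
  exact mul_pos (inv_pos.2 this) (Finset.sum_pos (fun x _ => likelihood_pos x u a) hS)

/-- Independent increments: given the symbol, observations at ratios u and v are independent and
their sum is the observation at ratio u + v. -/
lemma likelihood_add (x : ℂ) (u v : ℝ) (a b : ℂ) :
    likelihood x (u + v) (a + b) = likelihood x u a * likelihood x v b := by
  simp only [likelihood, ← Real.exp_add, inner_add_right]
  congr 1
  ring

@[fun_prop]
lemma continuous_likelihood {X : Type*} [TopologicalSpace X] (x : ℂ) {u : X → ℝ} {a : X → ℂ}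
    (hu : Continuous u) (ha : Continuous a) : Continuous fun y => likelihood x (u y) (a y) := by
  unfold likelihood
  fun_prop

@[fun_prop]
lemma continuous_mixture {X : Type*} [TopologicalSpace X] {u : X → ℝ} {a : X → ℂ}
    (hu : Continuous u) (ha : Continuous a) : Continuous fun y => mixture S (u y) (a y) := by
  unfold mixture
  fun_prop

section growth

variable {T E : Type*} [NormedAddCommGroup E] {U : T → ℝ} {A : T → E → ℂ} {M k : ℝ}

/-- The cases r = 1 and r = -1 give the likelihood and its reciprocal. The bound is uniform in t for
the later dominated convergence; where only integrability matters, T is `Unit`. -/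
lemma expBounded_exp_inner (x : ℂ) (r : ℝ) (hU : ∀ t, |U t| ≤ M) (hA : ∀ t v, ‖A t v‖ ≤ k * ‖v‖)
    (hk : 0 ≤ k) :
    ExpBounded fun t v => Real.exp (r * (2 * inner ℝ x (A t v) - U t * ‖x‖ ^ 2)) := by
  refine ⟨|r| * (2 * ‖x‖ * k), Real.exp (|r| * (M * ‖x‖ ^ 2)), by positivity, by positivity,
    fun t v => ?_⟩
  rw [abs_of_pos (Real.exp_pos _), ← Real.exp_add]
  refine Real.exp_le_exp.2 ((le_abs_self _).trans ?_)
  rw [abs_mul, mul_assoc |r|, ← mul_add]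
  refine mul_le_mul_of_nonneg_left ((abs_sub _ _).trans ?_) (abs_nonneg _)
  rw [abs_mul, abs_mul, abs_two, abs_of_nonneg (sq_nonneg ‖x‖), add_comm]
  refine add_le_add (mul_le_mul_of_nonneg_right (hU t) (sq_nonneg _)) ?_
  have h1 : |inner ℝ x (A t v)| ≤ ‖x‖ * (k * ‖v‖) := (abs_real_inner_le_norm _ _).trans
    (mul_le_mul_of_nonneg_left (hA t v) (norm_nonneg _))
  linarith

lemma expBounded_likelihood (x : ℂ) (hU : ∀ t, |U t| ≤ M) (hA : ∀ t v, ‖A t v‖ ≤ k * ‖v‖)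
    (hk : 0 ≤ k) : ExpBounded fun t v => likelihood x (U t) (A t v) := by
  simpa [likelihood] using expBounded_exp_inner x 1 hU hA hk

lemma expBounded_inv_likelihood (x : ℂ) (hU : ∀ t, |U t| ≤ M) (hA : ∀ t v, ‖A t v‖ ≤ k * ‖v‖)
    (hk : 0 ≤ k) : ExpBounded fun t v => (likelihood x (U t) (A t v))⁻¹ := by
  simpa only [likelihood, ← Real.exp_neg, neg_one_mul] using
    expBounded_exp_inner x (-1) hU hA hk

lemma expBounded_mixture (hU : ∀ t, |U t| ≤ M) (hA : ∀ t v, ‖A t v‖ ≤ k * ‖v‖)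
    (hk : 0 ≤ k) : ExpBounded fun t v => mixture S (U t) (A t v) :=
  (ExpBounded.const _).mul (ExpBounded.sum S fun x _ => expBounded_likelihood x hU hA hk)

/-- A single term of the average already bounds the mixture from below. -/
lemma expBounded_inv_mixture (hS : S.Nonempty) (hU : ∀ t, |U t| ≤ M)
    (hA : ∀ t v, ‖A t v‖ ≤ k * ‖v‖) (hk : 0 ≤ k) :
    ExpBounded fun t v => (mixture S (U t) (A t v))⁻¹ := by
  obtain ⟨x, hx⟩ := hS
  have hn : 0 < (S.card : ℝ) := by exact_mod_cast Finset.card_pos.2 ⟨x, hx⟩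
  refine ((ExpBounded.const (S.card : ℝ)).mul (expBounded_inv_likelihood x hU hA hk)).mono
    fun t v => ?_
  have hL := likelihood_pos x (U t) (A t v)
  have hle : (S.card : ℝ)⁻¹ * likelihood x (U t) (A t v) ≤ mixture S (U t) (A t v) :=
    mul_le_mul_of_nonneg_left (Finset.single_le_sum
      (f := fun x => likelihood x (U t) (A t v)) (fun y _ => (likelihood_pos y _ _).le) hx)
      (by positivity)
  rw [abs_of_pos (inv_pos.2 (mixture_pos ⟨x, hx⟩ _ _)), abs_of_pos (by positivity)]
  refine (inv_anti₀ (by positivity) hle).trans_eq ?_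
  rw [mul_inv, inv_inv]

lemma expBounded_log_likelihood (x : ℂ) (hU : ∀ t, |U t| ≤ M) (hA : ∀ t v, ‖A t v‖ ≤ k * ‖v‖)
    (hk : 0 ≤ k) : ExpBounded fun t v => Real.log (likelihood x (U t) (A t v)) :=
  (expBounded_likelihood x hU hA hk).log (expBounded_inv_likelihood x hU hA hk)
    fun _ _ => likelihood_pos _ _ _

lemma expBounded_log_mixture (hS : S.Nonempty) (hU : ∀ t, |U t| ≤ M)
    (hA : ∀ t v, ‖A t v‖ ≤ k * ‖v‖) (hk : 0 ≤ k) :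
    ExpBounded fun t v => Real.log (mixture S (U t) (A t v)) :=
  (expBounded_mixture hU hA hk).log (expBounded_inv_mixture hS hU hA hk)
    fun _ _ => mixture_pos hS _ _

end growth

lemma continuous_log_likelihood {X : Type*} [TopologicalSpace X] (x : ℂ) {u : X → ℝ} {a : X → ℂ}
    (hu : Continuous u) (ha : Continuous a) :
    Continuous fun y => Real.log (likelihood x (u y) (a y)) :=
  (continuous_likelihood x hu ha).log fun _ => (likelihood_pos _ _ _).ne'

lemma continuous_log_mixture (hS : S.Nonempty) {X : Type*} [TopologicalSpace X] {u : X → ℝ}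
    {a : X → ℂ} (hu : Continuous u) (ha : Continuous a) :
    Continuous fun y => Real.log (mixture S (u y) (a y)) :=
  (continuous_mixture hu ha).log fun _ => (mixture_pos hS _ _).ne'

lemma withDensity_likelihood {u : ℝ} (hu : 0 < u) (x : ℂ) :
    (complexGaussian u).withDensity (fun a => ENNReal.ofReal (likelihood x u a)) =
      (complexGaussian u).map (fun z => (u : ℂ) * x + z) := by
  rw [complexGaussian_map_const_add hu]
  congr with a
  have : (u : ℂ) * x = u • x := by simp
  rw [likelihood, this, real_inner_smul_left, norm_smul, Real.norm_of_nonneg hu.le]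
  congr 2
  field_simp

lemma integral_likelihood {u : ℝ} (hu : 0 < u) (x : ℂ) :
    ∫ a, likelihood x u a ∂(complexGaussian u) = 1 := by
  rw [integral_eq_lintegral_of_nonneg_ae (ae_of_all _ fun a => (likelihood_pos x u a).le)
    (by fun_prop), ← setLIntegral_univ, ← withDensity_apply _ MeasurableSet.univ,
    withDensity_likelihood hu]
  have : IsProbabilityMeasure ((complexGaussian u).map (fun z => (u : ℂ) * x + z)) :=
    Measure.isProbabilityMeasure_map (by fun_prop)
  simp

lemma integrable_likelihood (x : ℂ) (u : ℝ) (v : ℝ) :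
    Integrable (likelihood x u) (complexGaussian v) :=
  (expBounded_likelihood (T := Unit) (U := fun _ => u) (A := fun _ a => a) (k := 1) x
    (fun _ => le_rfl) (fun _ _ => by simp) zero_le_one).integrable () (by fun_prop) _

/-- The mixture density is a martingale in u: by `likelihood_add` the new increment factors off and
has mean one. -/
lemma integral_mixture_add {v : ℝ} (hv : 0 < v) (u : ℝ) (a : ℂ) :
    ∫ b, mixture S (u + v) (a + b) ∂(complexGaussian v) = mixture S u a := by
  simp_rw [mixture, likelihood_add]
  rw [integral_const_mul, integral_finsetSum _ fun x _ => (integrable_likelihood x v v).const_mul _]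
  simp_rw [integral_const_mul, integral_likelihood hv, mul_one]

end FDMA

end

-- Strict midpoint concavity by strong subadditivity

noncomputable section

namespace FDMA

variable {S : Finset ℂ}

lemma integral_pos_of_continuous {X : Type*} [TopologicalSpace X] [MeasurableSpace X]
    [OpensMeasurableSpace X] (μ : Measure X) [μ.IsOpenPosMeasure] {f : X → ℝ} (hf : Continuous f)
    (h0 : 0 ≤ f) (hi : Integrable f μ) {x : X} (hx : f x ≠ 0) : 0 < ∫ y, f y ∂μ :=
  (integral_pos_iff_support_of_nonneg h0 hi).2 (hf.isOpen_support.measure_pos μ ⟨x, hx⟩)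

lemma measurePreserving_add {u v : ℝ} (hu : 0 ≤ u) (hv : 0 ≤ v) :
    MeasurePreserving (fun p : ℂ × ℂ => p.1 + p.2)
      ((complexGaussian u).prod (complexGaussian v)) (complexGaussian (u + v)) :=
  ⟨by fun_prop, complexGaussian_add hu hv⟩

lemma measurePreserving_add_left_snd {u v w : ℝ} (hu : 0 ≤ u) (hv : 0 ≤ v) :
    MeasurePreserving (fun q : ℂ × ℂ × ℂ => (q.1 + q.2.1, q.2.2))
      ((complexGaussian u).prod ((complexGaussian v).prod (complexGaussian w)))
      ((complexGaussian (u + v)).prod (complexGaussian w)) :=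
  ((measurePreserving_add hu hv).prod (MeasurePreserving.id _)).comp
    (measurePreserving_prodAssoc _ _ _).symm

lemma measurePreserving_add_right_snd {u v w : ℝ} (hu : 0 ≤ u) (hw : 0 ≤ w) :
    MeasurePreserving (fun q : ℂ × ℂ × ℂ => (q.1 + q.2.2, q.2.1))
      ((complexGaussian u).prod ((complexGaussian v).prod (complexGaussian w)))
      ((complexGaussian (u + w)).prod (complexGaussian v)) :=
  (measurePreserving_add_left_snd hu hw).comp
    ((MeasurePreserving.id _).prod Measure.measurePreserving_swap)

lemma measurePreserving_add_add {u v w : ℝ} (hu : 0 ≤ u) (hv : 0 ≤ v) (hw : 0 ≤ w) :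
    MeasurePreserving (fun q : ℂ × ℂ × ℂ => q.1 + q.2.1 + q.2.2)
      ((complexGaussian u).prod ((complexGaussian v).prod (complexGaussian w)))
      (complexGaussian (u + v + w)) :=
  (measurePreserving_add (add_nonneg hu hv) hw).comp (measurePreserving_add_left_snd hu hv)

/-- Transport of an integral along a measure-preserving map that need not be an embedding. -/
lemma integral_comp_measurePreserving {X Y : Type*} [MeasurableSpace X] [TopologicalSpace Y]
    [MeasurableSpace Y] [OpensMeasurableSpace Y] [SecondCountableTopology Y] {μ : Measure X}
    {ν : Measure Y} {T : X → Y} (hT : MeasurePreserving T μ ν) {g : Y → ℝ} (hg : Continuous g) :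
    ∫ x, g (T x) ∂μ = ∫ y, g y ∂ν := by
  rw [← hT.map_eq, integral_map hT.measurable.aemeasurable hg.aestronglyMeasurable]

/-- The integrand of `gaussianInfo`. -/
def logRatio (S : Finset ℂ) (x : ℂ) (u : ℝ) (a : ℂ) : ℝ :=
  Real.log (likelihood x u a) - Real.log (mixture S u a)

lemma continuous_logRatio (hS : S.Nonempty) {X : Type*} [TopologicalSpace X] (x : ℂ) {u : X → ℝ}
    {a : X → ℂ} (hu : Continuous u) (ha : Continuous a) :
    Continuous fun y => logRatio S x (u y) (a y) :=
  (continuous_log_likelihood x hu ha).sub (continuous_log_mixture hS hu ha)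

lemma expBounded_logRatio (hS : S.Nonempty) {T E : Type*} [NormedAddCommGroup E] {U : T → ℝ}
    {A : T → E → ℂ} {M k : ℝ} (x : ℂ) (hU : ∀ t, |U t| ≤ M) (hA : ∀ t v, ‖A t v‖ ≤ k * ‖v‖)
    (hk : 0 ≤ k) : ExpBounded fun t v => logRatio S x (U t) (A t v) :=
  (expBounded_log_likelihood x hU hA hk).sub (expBounded_log_mixture hS hU hA hk)

/-- The pointwise gap in the strong subadditivity of entropy, for a symbol of `S` observed through
three conditionally independent channels. -/
def subadditivityGap (S : Finset ℂ) (u t : ℝ) (q : ℂ × ℂ × ℂ) : ℝ :=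
  mixture S (u + t) (q.1 + q.2.1) * mixture S (u + t) (q.1 + q.2.2) * (mixture S u q.1)⁻¹ *
    InformationTheory.klFun (mixture S (u + t + t) (q.1 + q.2.1 + q.2.2) * mixture S u q.1 *
      (mixture S (u + t) (q.1 + q.2.1) * mixture S (u + t) (q.1 + q.2.2))⁻¹)

/-- The log-likelihood is linear in (u, a), so its four occurrences cancel and the bracket is the
same for every x; averaging turns the likelihood into the mixture. The last summand comes from the
`1 - r` in `klFun r` and will integrate to zero. -/
lemma subadditivityGap_eq (hS : S.Nonempty) (u t : ℝ) (q : ℂ × ℂ × ℂ) :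
    subadditivityGap S u t q =
      (S.card : ℝ)⁻¹ * ∑ x ∈ S, likelihood x (u + t + t) (q.1 + q.2.1 + q.2.2) *
        (logRatio S x (u + t) (q.1 + q.2.1) + logRatio S x (u + t) (q.1 + q.2.2)
          - logRatio S x u q.1 - logRatio S x (u + t + t) (q.1 + q.2.1 + q.2.2)) +
      (mixture S (u + t) (q.1 + q.2.1) * mixture S (u + t) (q.1 + q.2.2) * (mixture S u q.1)⁻¹
        - mixture S (u + t + t) (q.1 + q.2.1 + q.2.2)) := by
  obtain ⟨a, b, c⟩ := q
  have hlog : ∀ x, logRatio S x (u + t) (a + b) + logRatio S x (u + t) (a + c)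
        - logRatio S x u a - logRatio S x (u + t + t) (a + b + c) =
      Real.log (mixture S (u + t + t) (a + b + c)) + Real.log (mixture S u a)
        - Real.log (mixture S (u + t) (a + b)) - Real.log (mixture S (u + t) (a + c)) := by
    intro x
    simp only [logRatio, likelihood, Real.log_exp, inner_add_right]
    ring
  have hsum : ∀ r : ℝ, (S.card : ℝ)⁻¹ * ∑ x ∈ S, likelihood x (u + t + t) (a + b + c) * r =
      mixture S (u + t + t) (a + b + c) * r := by
    intro r
    rw [← Finset.sum_mul, ← mul_assoc, mixture]
  simp only [hlog, hsum, subadditivityGap]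
  have h1 := mixture_pos hS (u + t + t) (a + b + c)
  have h2 := mixture_pos hS u a
  have h3 := mixture_pos hS (u + t) (a + b)
  have h4 := mixture_pos hS (u + t) (a + c)
  rw [InformationTheory.klFun, Real.log_mul (by positivity) (by positivity), Real.log_inv,
    Real.log_mul h1.ne' h2.ne', Real.log_mul h3.ne' h4.ne']
  field_simp
  ring

lemma subadditivityGap_nonneg (hS : S.Nonempty) (u t : ℝ) : 0 ≤ subadditivityGap S u t := by
  intro q
  have h1 := mixture_pos hS (u + t + t) (q.1 + q.2.1 + q.2.2)
  have h2 := mixture_pos hS u q.1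
  have h3 := mixture_pos hS (u + t) (q.1 + q.2.1)
  have h4 := mixture_pos hS (u + t) (q.1 + q.2.2)
  exact mul_nonneg (by positivity) (InformationTheory.klFun_nonneg (by positivity))

lemma continuous_subadditivityGap (hS : S.Nonempty) (u t : ℝ) :
    Continuous (subadditivityGap S u t) := by
  unfold subadditivityGap
  refine Continuous.mul (Continuous.mul (by fun_prop) (Continuous.inv₀ (by fun_prop)
    fun q => (mixture_pos hS _ _).ne')) (InformationTheory.continuous_klFun.comp
    (Continuous.mul (by fun_prop) (Continuous.inv₀ (by fun_prop)
    fun q => (mul_pos (mixture_pos hS _ _) (mixture_pos hS _ _)).ne')))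

/-- Strict Cauchy-Schwarz for a nonconstant function on a finite set with positive weights. -/
lemma sq_sum_mul_lt_sum_mul_sum {ι : Type*} (s : Finset ι) (w p : ι → ℝ) (hw : ∀ i ∈ s, 0 < w i)
    {i j : ι} (hi : i ∈ s) (hj : j ∈ s) (hij : p i ≠ p j) :
    (∑ x ∈ s, w x * p x) ^ 2 < (∑ x ∈ s, w x * p x ^ 2) * ∑ x ∈ s, w x := by
  have key : ∑ x ∈ s, ∑ y ∈ s, w x * w y * (p x - p y) ^ 2 =
      2 * ((∑ x ∈ s, w x * p x ^ 2) * (∑ x ∈ s, w x) - (∑ x ∈ s, w x * p x) ^ 2) := by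
    have e : ∀ x y, w x * w y * (p x - p y) ^ 2 = (w x * p x ^ 2) * w y + w x * (w y * p y ^ 2)
        - 2 * ((w x * p x) * (w y * p y)) := fun x y => by ring
    simp_rw [e, Finset.sum_sub_distrib, Finset.sum_add_distrib, ← Finset.mul_sum,
      ← Finset.sum_mul]
    ring
  have hpos : 0 < ∑ x ∈ s, ∑ y ∈ s, w x * w y * (p x - p y) ^ 2 := by
    have hnn : ∀ x ∈ s, ∀ y ∈ s, 0 ≤ w x * w y * (p x - p y) ^ 2 := fun x hx y hy =>
      mul_nonneg (mul_pos (hw x hx) (hw y hy)).le (sq_nonneg _)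
    refine Finset.sum_pos' (fun x hx => Finset.sum_nonneg (hnn x hx)) ⟨i, hi, ?_⟩
    exact Finset.sum_pos' (hnn i hi) ⟨j, hj, mul_pos (mul_pos (hw i hi) (hw j hj))
      (by have := sub_ne_zero.2 hij; positivity)⟩
  linarith

/-- The exponents are affine in b with slopes 2x and 2y; agreement at 0 and at x - y would force ‖x
- y‖² = 0. -/
lemma exists_likelihood_ne {x y : ℂ} (hxy : x ≠ y) (t : ℝ) :
    ∃ b, likelihood x t b ≠ likelihood y t b := by
  by_contra! h
  simp only [likelihood, Real.exp_eq_exp] at h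
  have h0 := h 0
  have h1 := h (x - y)
  rw [inner_zero_right, inner_zero_right] at h0
  have : inner ℝ (x - y) (x - y) = (0 : ℝ) := by
    rw [inner_sub_left]
    linarith
  exact hxy (sub_eq_zero.1 (inner_self_eq_zero.1 this))

/-- At (0, b, b), a zero gap is equality in Cauchy-Schwarz for the function `likelihood x t b` of x
with weights `likelihood x u 0`. Choosing b to separate two symbols excludes it. -/
lemma exists_subadditivityGap_ne_zero (hS : S.Nontrivial) (u t : ℝ) :
    ∃ q, subadditivityGap S u t q ≠ 0 := by
  obtain ⟨x, hx, y, hy, hxy⟩ := hS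
  obtain ⟨b, hb⟩ := exists_likelihood_ne hxy t
  have hS : S.Nonempty := ⟨x, hx⟩
  refine ⟨(0, b, b), fun h => ?_⟩
  have h1 := mixture_pos hS (u + t + t) (0 + b + b)
  have h2 := mixture_pos hS u 0
  have h3 := mixture_pos hS (u + t) (0 + b)
  have hn : 0 < (S.card : ℝ) := by exact_mod_cast hS.card_pos
  simp only [subadditivityGap] at h
  rcases mul_eq_zero.1 h with h | h
  · exact absurd h (by positivity)
  rw [InformationTheory.klFun_eq_zero_iff (by positivity), mul_inv_eq_one₀ (by positivity)] at h
  have hlt := sq_sum_mul_lt_sum_mul_sum S (fun x => likelihood x u 0) (fun x => likelihood x t b)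
    (fun _ _ => likelihood_pos _ _ _) hx hy hb
  simp only [mixture, likelihood_add, mul_assoc] at h
  field_simp at h
  linarith

lemma continuous_likelihood_mul_logRatio (hS : S.Nonempty) (x : ℂ) (u : ℝ) :
    Continuous fun a => likelihood x u a * logRatio S x u a :=
  (continuous_likelihood x continuous_const continuous_id).mul
    (continuous_logRatio hS x continuous_const continuous_id)

/-- The log ratio sees only A, so the likelihood factor of the increment C integrates to one. -/
lemma integral_likelihood_mul_logRatio {u v : ℝ} (hS : S.Nonempty) (hv : 0 < v)
    (x : ℂ) {X : Type*} [MeasurableSpace X] {Q : Measure X} {A C : X → ℂ}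
    (h : MeasurePreserving (fun q => (A q, C q)) Q
      ((complexGaussian u).prod (complexGaussian v))) :
    ∫ q, likelihood x (u + v) (A q + C q) * logRatio S x u (A q) ∂Q =
      ∫ a, likelihood x u a * logRatio S x u a ∂(complexGaussian u) := by
  have hc : Continuous fun p : ℂ × ℂ => likelihood x (u + v) (p.1 + p.2) * logRatio S x u p.1 :=
    (continuous_likelihood x continuous_const (by fun_prop)).mul
      (continuous_logRatio hS x continuous_const continuous_fst)
  rw [integral_comp_measurePreserving h hc]
  have e : ∀ p : ℂ × ℂ, likelihood x (u + v) (p.1 + p.2) * logRatio S x u p.1 =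
      likelihood x u p.1 * logRatio S x u p.1 * likelihood x v p.2 := fun p => by
    rw [likelihood_add, mul_right_comm]
  simp_rw [e]
  rw [integral_prod_mul (fun a => likelihood x u a * logRatio S x u a) (likelihood x v),
    integral_likelihood hv, mul_one]

theorem gaussianInfo_midpoint (hS : S.Nontrivial) {u t : ℝ} (hu : 0 < u) (ht : 0 < t) :
    gaussianInfo S u + gaussianInfo S (u + t + t) < 2 * gaussianInfo S (u + t) := by
  have hne := hS.nonempty
  set Q := (complexGaussian u).prod ((complexGaussian t).prod (complexGaussian t)) with hQ
  have := isOpenPosMeasure_complexGaussian hu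
  have := isOpenPosMeasure_complexGaussian ht
  -- Each observation is a sum of at most three coordinates, so the growth constant 3 serves for
  -- all.
  have n1 : ∀ q : ℂ × ℂ × ℂ, ‖q.1‖ ≤ ‖q‖ := fun q => norm_fst_le q
  have n2 : ∀ q : ℂ × ℂ × ℂ, ‖q.2.1‖ ≤ ‖q‖ := fun q => (norm_fst_le _).trans (norm_snd_le q)
  have n3 : ∀ q : ℂ × ℂ × ℂ, ‖q.2.2‖ ≤ ‖q‖ := fun q => (norm_snd_le _).trans (norm_snd_le q)
  have a1 : ∀ (_ : Unit) (q : ℂ × ℂ × ℂ), ‖q.1‖ ≤ 3 * ‖q‖ := fun _ q => by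
    linarith [n1 q, norm_nonneg q]
  have a2 : ∀ (_ : Unit) (q : ℂ × ℂ × ℂ), ‖q.1 + q.2.1‖ ≤ 3 * ‖q‖ := fun _ q => by
    linarith [n1 q, n2 q, norm_nonneg q, norm_add_le q.1 q.2.1]
  have a3 : ∀ (_ : Unit) (q : ℂ × ℂ × ℂ), ‖q.1 + q.2.2‖ ≤ 3 * ‖q‖ := fun _ q => by
    linarith [n1 q, n3 q, norm_nonneg q, norm_add_le q.1 q.2.2]
  have a4 : ∀ (_ : Unit) (q : ℂ × ℂ × ℂ), ‖q.1 + q.2.1 + q.2.2‖ ≤ 3 * ‖q‖ := fun _ q => by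
    linarith [n1 q, n2 q, n3 q, norm_add_le (q.1 + q.2.1) q.2.2, norm_add_le q.1 q.2.1]
  have h3 : (0 : ℝ) ≤ 3 := by norm_num
  have bd : ∀ v : ℝ, ∀ _ : Unit, |v| ≤ |v| := fun v _ => le_rfl
  have int : ∀ (x : ℂ) (v : ℝ) (A : ℂ × ℂ × ℂ → ℂ), Continuous A →
      (∀ (_ : Unit) q, ‖A q‖ ≤ 3 * ‖q‖) → Integrable (fun q =>
        likelihood x (u + t + t) (q.1 + q.2.1 + q.2.2) * logRatio S x v (A q)) Q := by
    intro x v A hAc hA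
    exact ((expBounded_likelihood x (bd _) a4 h3).mul
      (expBounded_logRatio hne x (bd v) hA h3)).integrable ()
      ((continuous_likelihood x continuous_const (by fun_prop)).mul
        (continuous_logRatio hne x continuous_const hAc)) Q
  have i1 := fun x => int x u (fun q => q.1) (by fun_prop) a1
  have i2 := fun x => int x (u + t) (fun q => q.1 + q.2.1) (by fun_prop) a2
  have i3 := fun x => int x (u + t) (fun q => q.1 + q.2.2) (by fun_prop) a3
  have i4 := fun x => int x (u + t + t) (fun q => q.1 + q.2.1 + q.2.2) (by fun_prop) a4
  have e1 : ∀ x, ∫ q, likelihood x (u + t + t) (q.1 + q.2.1 + q.2.2) * logRatio S x u q.1 ∂Q =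
      ∫ a, likelihood x u a * logRatio S x u a ∂(complexGaussian u) := by
    intro x
    have := integral_likelihood_mul_logRatio (Q := Q) (A := fun q => q.1)
      (C := fun q => q.2.1 + q.2.2) (v := t + t) hne (by positivity) x
      ((MeasurePreserving.id _).prod (measurePreserving_add ht.le ht.le))
    simpa only [add_assoc] using this
  have e2 : ∀ x, ∫ q, likelihood x (u + t + t) (q.1 + q.2.1 + q.2.2) *
      logRatio S x (u + t) (q.1 + q.2.1) ∂Q =
      ∫ a, likelihood x (u + t) a * logRatio S x (u + t) a ∂(complexGaussian (u + t)) := fun x =>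
    integral_likelihood_mul_logRatio hne ht x (measurePreserving_add_left_snd hu.le ht.le)
  have e3 : ∀ x, ∫ q, likelihood x (u + t + t) (q.1 + q.2.1 + q.2.2) *
      logRatio S x (u + t) (q.1 + q.2.2) ∂Q =
      ∫ a, likelihood x (u + t) a * logRatio S x (u + t) a ∂(complexGaussian (u + t)) := fun x => by
    simpa only [add_right_comm _ (Prod.snd (Prod.snd _))] using
      integral_likelihood_mul_logRatio hne ht x (measurePreserving_add_right_snd hu.le ht.le)
  have e4 : ∀ x, ∫ q, likelihood x (u + t + t) (q.1 + q.2.1 + q.2.2) *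
      logRatio S x (u + t + t) (q.1 + q.2.1 + q.2.2) ∂Q =
      ∫ a, likelihood x (u + t + t) a * logRatio S x (u + t + t) a
        ∂(complexGaussian (u + t + t)) := fun x =>
    integral_comp_measurePreserving (measurePreserving_add_add hu.le ht.le ht.le)
      (continuous_likelihood_mul_logRatio hne x (u + t + t))
  have ix : ∀ x, Integrable (fun q => likelihood x (u + t + t) (q.1 + q.2.1 + q.2.2) *
        (logRatio S x (u + t) (q.1 + q.2.1) + logRatio S x (u + t) (q.1 + q.2.2)
          - logRatio S x u q.1 - logRatio S x (u + t + t) (q.1 + q.2.1 + q.2.2))) Q := by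
    intro x
    simp_rw [mul_sub, mul_add]
    exact (((i2 x).add (i3 x)).sub (i1 x)).sub (i4 x)
  have hx : ∀ x, ∫ q, likelihood x (u + t + t) (q.1 + q.2.1 + q.2.2) *
        (logRatio S x (u + t) (q.1 + q.2.1) + logRatio S x (u + t) (q.1 + q.2.2)
          - logRatio S x u q.1 - logRatio S x (u + t + t) (q.1 + q.2.1 + q.2.2)) ∂Q =
      2 * ∫ a, likelihood x (u + t) a * logRatio S x (u + t) a ∂(complexGaussian (u + t))
      - ∫ a, likelihood x u a * logRatio S x u a ∂(complexGaussian u)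
      - ∫ a, likelihood x (u + t + t) a * logRatio S x (u + t + t) a
        ∂(complexGaussian (u + t + t)) := by
    intro x
    simp_rw [mul_sub, mul_add]
    refine (integral_sub (((i2 x).add (i3 x)).sub (i1 x)) (i4 x)).trans ?_
    rw [integral_sub' ((i2 x).add (i3 x)) (i1 x), integral_add' (i2 x) (i3 x), e1, e2, e3, e4]
    ring
  have iM : Integrable (fun q => mixture S (u + t + t) (q.1 + q.2.1 + q.2.2)) Q :=
    (expBounded_mixture (bd _) a4 h3).integrable () (by fun_prop) Q
  have iR : Integrable (fun q => mixture S (u + t) (q.1 + q.2.1) *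
      mixture S (u + t) (q.1 + q.2.2) * (mixture S u q.1)⁻¹) Q :=
    (((expBounded_mixture (bd _) a2 h3).mul (expBounded_mixture (bd _) a3 h3)).mul
      (expBounded_inv_mixture hne (bd _) a1 h3)).integrable ()
      (Continuous.mul (by fun_prop) (Continuous.inv₀ (by fun_prop)
        fun q => (mixture_pos hne _ _).ne')) Q
  -- The martingale property started at u = 0, a = 0, where the mixture equals 1.
  have one : ∀ {v : ℝ}, 0 < v → ∫ a, mixture S v a ∂(complexGaussian v) = 1 := by
    intro v hv
    have hn : (S.card : ℝ) ≠ 0 := by exact_mod_cast hne.card_pos.ne'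
    have := integral_mixture_add (S := S) hv 0 0
    simp only [zero_add] at this
    rw [this]
    simp [mixture, likelihood, hn]
  have eM : ∫ q, mixture S (u + t + t) (q.1 + q.2.1 + q.2.2) ∂Q = 1 := by
    rw [integral_comp_measurePreserving (measurePreserving_add_add hu.le ht.le ht.le)
      (g := fun a => mixture S (u + t + t) a) (by fun_prop), one (by positivity)]
  -- The Markov law has mass one: for fixed a the integrals over b and c each return `mixture S u
  -- a`, one of which the denominator cancels.
  have eR : ∫ q, mixture S (u + t) (q.1 + q.2.1) *
      mixture S (u + t) (q.1 + q.2.2) * (mixture S u q.1)⁻¹ ∂Q = 1 := by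
    rw [hQ, integral_prod _ iR]
    have inner : ∀ a, ∫ p : ℂ × ℂ, mixture S (u + t) (a + p.1) * mixture S (u + t) (a + p.2) *
        (mixture S u a)⁻¹ ∂((complexGaussian t).prod (complexGaussian t)) = mixture S u a := by
      intro a
      rw [integral_mul_const, integral_prod_mul (fun b => mixture S (u + t) (a + b))
        (fun b => mixture S (u + t) (a + b)), integral_mixture_add ht]
      field_simp [(mixture_pos hne u a).ne']
    simp_rw [inner]
    exact one hu
  have iS := (integrable_finsetSum S fun x _ => ix x).const_mul (S.card : ℝ)⁻¹
  have hgap : ∫ q, subadditivityGap S u t q ∂Q =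
      2 * gaussianInfo S (u + t) - gaussianInfo S u - gaussianInfo S (u + t + t) := by
    simp_rw [subadditivityGap_eq hne]
    refine (integral_add iS (iR.sub iM)).trans ?_
    rw [integral_sub' iR iM, eM, eR, integral_const_mul,
      integral_finsetSum S fun x _ => ix x]
    simp_rw [hx, Finset.sum_sub_distrib, ← Finset.mul_sum]
    simp only [gaussianInfo, logRatio]
    ring
  have hint : Integrable (subadditivityGap S u t) Q := by
    have := iS.add (iR.sub iM)
    refine this.congr (ae_of_all _ fun q => ?_)
    simp only [Pi.add_apply, Pi.sub_apply, subadditivityGap_eq hne]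
  obtain ⟨q, hq⟩ := exists_subadditivityGap_ne_zero hS u t
  have := integral_pos_of_continuous Q (continuous_subadditivityGap hne u t)
    (subadditivityGap_nonneg hne u t) hint hq
  rw [hgap] at this
  linarith

end FDMA

end

-- Continuity, strict concavity and scaling of the information

noncomputable section

namespace FDMA

variable {S : Finset ℂ}

lemma continuousOn_gaussianInfo (hS : S.Nonempty) : ContinuousOn (gaussianInfo S) (Set.Ioi 0) := by
  suffices h : ∀ M : ℝ, ContinuousOn (gaussianInfo S) (Set.Icc 0 M) from fun u hu =>
    ((h (u + 1)).continuousAt (Icc_mem_nhds hu (lt_add_one u))).continuousWithinAt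
  intro M
  have hcont : ∀ x, ContinuousOn (fun u => ∫ a, likelihood x u a * logRatio S x u a
      ∂(complexGaussian u)) (Set.Icc 0 M) := by
    intro x
    rw [continuousOn_iff_continuous_domRestrict]
    -- Scaling by √u moves the dependence on u from the measure to the integrand, so dominated
    -- convergence applies against one fixed Gaussian.
    have heq : (Set.Icc 0 M).domRestrict (fun u => ∫ a, likelihood x u a * logRatio S x u a
        ∂(complexGaussian u)) = fun u : Set.Icc 0 M => ∫ a,
          likelihood x u ((√(u : ℝ) : ℂ) * a) * logRatio S x u ((√(u : ℝ) : ℂ) * a)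
          ∂(complexGaussian 1) := by
      ext u
      have h := complexGaussian_map_mul (√(u : ℝ)) zero_le_one
      rw [Real.sq_sqrt u.2.1, mul_one] at h
      rw [Set.domRestrict_apply, ← h, integral_map (by fun_prop)
        (continuous_likelihood_mul_logRatio hS x u).aestronglyMeasurable]
    rw [heq]
    have hU : ∀ u : Set.Icc 0 M, |(u : ℝ)| ≤ M := fun u => by
      rw [abs_of_nonneg u.2.1]; exact u.2.2
    have hA : ∀ (u : Set.Icc 0 M) (a : ℂ), ‖(√(u : ℝ) : ℂ) * a‖ ≤ √M * ‖a‖ := fun u a => by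
      rw [norm_mul, Complex.norm_real, Real.norm_of_nonneg (Real.sqrt_nonneg _)]
      exact mul_le_mul_of_nonneg_right (Real.sqrt_le_sqrt u.2.2) (norm_nonneg _)
    obtain ⟨c, K, -, -, hb⟩ := (expBounded_likelihood x hU hA (Real.sqrt_nonneg _)).mul
      (expBounded_logRatio hS x hU hA (Real.sqrt_nonneg _))
    refine continuous_of_dominated (fun u => ?_) (fun u => ae_of_all _ (hb u))
      ((integrable_exp_norm _ c).const_mul K) (ae_of_all _ fun a => ?_)
    · exact ((continuous_likelihood_mul_logRatio hS x u).comp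
        (continuous_const_mul _)).aestronglyMeasurable
    · exact (continuous_likelihood x (by fun_prop) (by fun_prop)).mul
        (continuous_logRatio hS x (by fun_prop) (by fun_prop))
  exact continuousOn_const.mul (continuousOn_finsetSum S fun x _ => hcont x)

/-- A continuous strictly midpoint-concave function is strictly concave. -/
lemma strictConcaveOn_of_midpoint {s : Set ℝ} (hs : Convex ℝ s) {f : ℝ → ℝ}
    (hc : ContinuousOn f s)
    (hm : ∀ u t, u ∈ s → u + t + t ∈ s → 0 < t → f u + f (u + t + t) < 2 * f (u + t)) :
    StrictConcaveOn ℝ s f := by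
  refine LinearOrder.strictConcaveOn_of_lt hs fun x hx y hy hxy a b ha hb hab => ?_
  have hsub : Set.Icc x y ⊆ s := hs.ordConnected.out hx hy
  set k := (f y - f x) / (y - x) with hk
  have hyx : 0 < y - x := sub_pos.2 hxy
  have hky : k * (y - x) = f y - f x := div_mul_cancel₀ _ hyx.ne'
  -- The function minus its chord over [x, y]; failure of strict concavity at w means g w ≤ 0.
  set g : ℝ → ℝ := fun z => f z - f x - k * (z - x) with hg
  have hgx : g x = 0 := by simp [hg]
  have hgy : g y = 0 := by simp only [hg, hky]; ring
  have hgc : ContinuousOn g (Set.Icc x y) :=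
    ((hc.mono hsub).sub continuousOn_const).sub (by fun_prop)
  simp only [smul_eq_mul]
  set w := a * x + b * y with hw
  have hwx : w - x = b * (y - x) := by grind
  have hwy : y - w = a * (y - x) := by grind
  have hxw : x < w := by nlinarith
  have hwy' : w < y := by nlinarith
  by_contra! hle
  have hgw : g w ≤ 0 := by
    have : k * (w - x) = b * (f y - f x) := by rw [hwx, ← hky]; ring
    have h2 : a * f x + b * f y = f x + b * (f y - f x) := by grind
    simp only [hg, this]
    linarith
  obtain ⟨c, hcm, hmin⟩ := isCompact_Icc.exists_isMinOn (Set.nonempty_Icc.2 hxy.le) hgc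
  -- The minimum of g is attained inside: a negative minimum cannot lie at an endpoint, and
  -- otherwise w itself attains it. An interior minimum contradicts strict midpoint concavity at d -
  -- t, d, d + t.
  obtain ⟨d, hxd, hdy, hd⟩ : ∃ d, x < d ∧ d < y ∧ ∀ z ∈ Set.Icc x y, g d ≤ g z := by
    by_cases h0 : g c < 0
    · refine ⟨c, lt_of_le_of_ne hcm.1 ?_, lt_of_le_of_ne hcm.2 ?_, fun z hz => hmin hz⟩
      · rintro rfl; linarith
      · rintro rfl; linarith
    · exact ⟨w, hxw, hwy', fun z hz => hgw.trans ((not_lt.1 h0).trans (hmin hz))⟩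
  set t := min (d - x) (y - d) with ht
  have ht0 : 0 < t := lt_min (sub_pos.2 hxd) (sub_pos.2 hdy)
  have ht1 : t ≤ d - x := min_le_left _ _
  have ht2 : t ≤ y - d := min_le_right _ _
  have m1 : d - t ∈ Set.Icc x y := ⟨by linarith, by linarith⟩
  have m2 : d - t + t + t ∈ Set.Icc x y := ⟨by linarith, by linarith⟩
  have h1 := hd _ m1
  have h2 := hd _ m2
  have h3 := hm (d - t) t (hsub m1) (hsub m2) ht0
  rw [sub_add_cancel] at h2 h3
  simp only [hg] at h1 h2
  linarith

lemma strictConcaveOn_gaussianInfo (hS : S.Nontrivial) :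
    StrictConcaveOn ℝ (Set.Ioi 0) (gaussianInfo S) :=
  strictConcaveOn_of_midpoint (convex_Ioi 0) (continuousOn_gaussianInfo hS.nonempty)
    fun _ _ hu _ ht => gaussianInfo_midpoint hS hu ht

lemma gaussianInfo_singleton (x : ℂ) (u : ℝ) : gaussianInfo {x} u = 0 := by
  simp [gaussianInfo, mixture]

/-- Amplifying the symbols by c multiplies the ratio by c². With c = √P this absorbs the transmit
power. -/
lemma gaussianInfo_image_mul (c : ℝ) (hc : c ≠ 0) (hS : S.Nonempty) {u : ℝ} (hu : 0 ≤ u) :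
    gaussianInfo (S.image fun x => (c : ℂ) * x) u = gaussianInfo S (c ^ 2 * u) := by
  have hinj : Function.Injective fun x : ℂ => (c : ℂ) * x :=
    mul_right_injective₀ (by exact_mod_cast hc)
  have hL : ∀ x a, likelihood ((c : ℂ) * x) u a = likelihood x (c ^ 2 * u) ((c : ℂ) * a) := by
    intro x a
    have h : ∀ z : ℂ, (c : ℂ) * z = c • z := fun z => by simp
    rw [likelihood, likelihood, h, h, real_inner_smul_left, real_inner_smul_right, norm_smul,
      mul_pow, Real.norm_eq_abs, sq_abs]
    congr 1
    ring
  have hF : ∀ a, mixture (S.image fun x => (c : ℂ) * x) u a =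
      mixture S (c ^ 2 * u) ((c : ℂ) * a) := by
    intro a
    simp only [mixture, Finset.card_image_of_injective S hinj,
      Finset.sum_image hinj.injOn, hL]
  simp only [gaussianInfo, Finset.card_image_of_injective S hinj, Finset.sum_image hinj.injOn, hL,
    hF]
  congr 1
  refine Finset.sum_congr rfl fun x _ => ?_
  rw [← complexGaussian_map_mul c hu]
  exact (integral_map (by fun_prop)
    (continuous_likelihood_mul_logRatio hS x _).aestronglyMeasurable).symm

end FDMA

end

-- From conditional mutual information to `gaussianInfo`

noncomputable section

namespace FDMA

variable {S : Finset ℂ}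

lemma uniformOn_finset_eq_smul_sum_dirac (S : Finset ℂ) :
    uniformOn (S : Set ℂ) = (S.card : ℝ≥0∞)⁻¹ • ∑ x ∈ S, Measure.dirac x := by
  classical
  ext s hs
  rw [uniformOn, cond_apply S.measurableSet, Measure.count_apply_finset, Measure.smul_apply,
    Measure.finsetSum_apply, smul_eq_mul]
  have h : (S : Set ℂ) ∩ s = (S.filter (· ∈ s) : Finset ℂ) := by ext; simp
  rw [h, Measure.count_apply_finset, Finset.card_filter]
  simp [Measure.dirac_apply' _ hs, Set.indicator_apply]

lemma isProbabilityMeasure_uniformOn_finset (hS : S.Nonempty) :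
    IsProbabilityMeasure (uniformOn (S : Set ℂ)) :=
  isProbabilityMeasure_uniformOn S.finite_toSet hS

lemma uniformOn_map_mul {c : ℝ} (hc : c ≠ 0) (S : Finset ℂ) :
    (uniformOn (S : Set ℂ)).map (fun x => (c : ℂ) * x) =
      uniformOn ((S.image fun x => (c : ℂ) * x : Finset ℂ) : Set ℂ) := by
  have hinj : Function.Injective fun x : ℂ => (c : ℂ) * x :=
    mul_right_injective₀ (by exact_mod_cast hc)
  rw [uniformOn_finset_eq_smul_sum_dirac, uniformOn_finset_eq_smul_sum_dirac,
    Finset.card_image_of_injective S hinj, Finset.sum_image hinj.injOn, Measure.map_smul,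
    Measure.map_finset_sum (by fun_prop)]
  simp_rw [Measure.map_dirac' (by fun_prop : Measurable fun x : ℂ => (c : ℂ) * x)]

lemma uniformOn_prod (S : Finset ℂ) (ν : Measure ℂ) [SFinite ν] :
    (uniformOn (S : Set ℂ)).prod ν = (S.card : ℝ≥0∞)⁻¹ • ∑ x ∈ S, ν.map (Prod.mk x) := by
  rw [uniformOn_finset_eq_smul_sum_dirac, Measure.prod_smul_left, ← Measure.sum_coe_finset,
    Measure.prod_sum_left, ← Measure.sum_coe_finset]
  simp_rw [Measure.dirac_prod]

lemma integrable_uniformOn_prod {ν : Measure ℂ} [SFinite ν] (hS : S.Nonempty)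
    {f : ℂ × ℂ → ℝ} (hf : Continuous f) (h : ∀ x ∈ S, Integrable (fun y => f (x, y)) ν) :
    Integrable f ((uniformOn (S : Set ℂ)).prod ν) := by
  rw [uniformOn_prod]
  refine Integrable.smul_measure (integrable_finsetSum_measure.2 fun x hx => ?_)
    (by simpa using hS.ne_empty)
  rw [integrable_map_measure hf.aestronglyMeasurable (by fun_prop)]
  exact h x hx

lemma integral_uniformOn_prod {ν : Measure ℂ} [SFinite ν]
    {f : ℂ × ℂ → ℝ} (hf : Continuous f) (h : ∀ x ∈ S, Integrable (fun y => f (x, y)) ν) :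
    ∫ p, f p ∂((uniformOn (S : Set ℂ)).prod ν) = (S.card : ℝ)⁻¹ * ∑ x ∈ S, ∫ y, f (x, y) ∂ν := by
  rw [uniformOn_prod, integral_smul_measure, integral_finsetSum_measure]
  · rw [ENNReal.toReal_inv, ENNReal.toReal_natCast, smul_eq_mul]
    congr 1
    refine Finset.sum_congr rfl fun x _ => ?_
    rw [integral_map (by fun_prop) hf.aestronglyMeasurable]
  · intro x hx
    rw [integrable_map_measure hf.aestronglyMeasurable (by fun_prop)]
    exact h x hx

/-- Dividing m + noise of variance w by w gives mean m/w and variance 1/w, the normalization of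
`likelihood` at u = 1/w. -/
lemma complexGaussian_map_const_add_eq_likelihood {w : ℝ} (hw : 0 < w) (m : ℂ) :
    (complexGaussian w).map (fun z => m + z) = (complexGaussian w).withDensity
      (fun y => ENNReal.ofReal (likelihood m w⁻¹ ((w⁻¹ : ℝ) * y))) := by
  rw [complexGaussian_map_const_add hw]
  congr with y
  have h : ((w⁻¹ : ℝ) : ℂ) * y = w⁻¹ • y := by simp
  rw [likelihood, h, real_inner_smul_right]
  congr 2
  field_simp

@[fun_prop]
lemma continuous_likelihood_uncurry {X : Type*} [TopologicalSpace X] {m : X → ℂ} {u : X → ℝ}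
    {a : X → ℂ} (hm : Continuous m) (hu : Continuous u) (ha : Continuous a) :
    Continuous fun y => likelihood (m y) (u y) (a y) := by
  unfold likelihood
  fun_prop

lemma map_prodMk_add_eq_withDensity {w : ℝ} (hw : 0 < w) (τ : Measure ℂ) [SFinite τ] :
    (τ.prod (complexGaussian w)).map (fun p => (p.1, p.1 + p.2)) =
      (τ.prod (complexGaussian w)).withDensity
        (fun p => ENNReal.ofReal (likelihood p.1 w⁻¹ ((w⁻¹ : ℝ) * p.2))) := by
  ext s hs
  have hm : Measurable fun p : ℂ × ℂ => (p.1, p.1 + p.2) := by fun_prop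
  have hd : Measurable fun p : ℂ × ℂ =>
      ENNReal.ofReal (likelihood p.1 w⁻¹ ((w⁻¹ : ℝ) * p.2)) :=
    ENNReal.measurable_ofReal.comp (Continuous.measurable (by fun_prop))
  rw [Measure.map_apply hm hs, withDensity_apply _ hs, Measure.prod_apply (hm hs),
    ← lintegral_indicator hs, lintegral_prod _ (hd.indicator hs).aemeasurable]
  refine lintegral_congr fun a => ?_
  have hsa : MeasurableSet (Prod.mk a ⁻¹' s) := measurable_prodMk_left hs
  have h := congrArg (fun μ : Measure ℂ => μ (Prod.mk a ⁻¹' s))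
    (complexGaussian_map_const_add_eq_likelihood hw a)
  rw [Measure.map_apply (by fun_prop) hsa, withDensity_apply _ hsa,
    ← lintegral_indicator hsa] at h
  exact h

lemma lintegral_likelihood_uniformOn (hS : S.Nonempty) (u : ℝ) (a : ℂ) :
    ∫⁻ x, ENNReal.ofReal (likelihood x u a) ∂(uniformOn (S : Set ℂ)) =
      ENNReal.ofReal (mixture S u a) := by
  have hn : 0 < (S.card : ℝ) := by exact_mod_cast hS.card_pos
  rw [uniformOn_finset_eq_smul_sum_dirac, lintegral_smul_measure, lintegral_finsetSum_measure]
  simp_rw [lintegral_dirac]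
  rw [mixture, ENNReal.ofReal_mul (by positivity), ENNReal.ofReal_inv_of_pos hn,
    ENNReal.ofReal_natCast, ENNReal.ofReal_sum_of_nonneg fun x _ => (likelihood_pos x u a).le,
    smul_eq_mul]

lemma map_snd_withDensity_likelihood (hS : S.Nonempty) {γ : Measure ℂ} [SFinite γ] (c : ℂ) (u : ℝ) :
    (((uniformOn (S : Set ℂ)).prod γ).withDensity
      fun p => ENNReal.ofReal (likelihood p.1 u (c * p.2))).map Prod.snd =
      γ.withDensity (fun y => ENNReal.ofReal (mixture S u (c * y))) := by
  have hm : Measurable fun p : ℂ × ℂ => ENNReal.ofReal (likelihood p.1 u (c * p.2)) :=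
    ENNReal.measurable_ofReal.comp (Continuous.measurable (by fun_prop))
  ext s hs
  rw [Measure.map_apply measurable_snd hs, withDensity_apply _ (measurable_snd hs),
    withDensity_apply _ hs, ← lintegral_indicator (measurable_snd hs),
    lintegral_prod_symm _ (hm.indicator (measurable_snd hs)).aemeasurable,
    ← lintegral_indicator hs]
  refine lintegral_congr fun y => ?_
  by_cases hy : y ∈ s
  · rw [Set.indicator_of_mem hy]
    simp only [Set.indicator, Set.mem_preimage, hy, if_true]
    exact lintegral_likelihood_uniformOn hS _ _
  · rw [Set.indicator_of_notMem hy]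
    simp [Set.indicator, hy]

/-- The log-likelihood ratio of two measures with positive densities. -/
lemma llr_withDensity {X : Type*} [MeasurableSpace X] {β ρ π : Measure X} [SigmaFinite π]
    {l f : X → ℝ} (hl : Measurable l) (hf : Measurable f) (hlp : ∀ x, 0 < l x)
    (hfp : ∀ x, 0 < f x) (hρ : ρ = β.withDensity fun x => ENNReal.ofReal (l x))
    (hπ : π = β.withDensity fun x => ENNReal.ofReal (f x)) :
    ρ ≪ π ∧ llr ρ π =ᵐ[ρ] fun x => Real.log (l x) - Real.log (f x) := by
  have hrm : Measurable fun x => ENNReal.ofReal (l x / f x) :=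
    ENNReal.measurable_ofReal.comp (hl.div hf)
  have hρπ : ρ = π.withDensity (fun x => ENNReal.ofReal (l x / f x)) := by
    have hfm : Measurable fun x => ENNReal.ofReal (f x) := ENNReal.measurable_ofReal.comp hf
    rw [hπ, ← withDensity_mul _ hfm hrm, hρ]
    congr with x
    rw [Pi.mul_apply, ← ENNReal.ofReal_mul (hfp _).le, mul_div_cancel₀ _ (hfp _).ne']
  have hac : ρ ≪ π := by
    rw [hρπ]
    exact withDensity_absolutelyContinuous _ _
  refine ⟨hac, ?_⟩
  have h : ρ.rnDeriv π =ᵐ[π] fun x => ENNReal.ofReal (l x / f x) := by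
    conv_lhs => rw [hρπ]
    exact Measure.rnDeriv_withDensity _ hrm
  filter_upwards [hac.ae_le h] with x hx
  rw [llr_def]
  simp only
  rw [hx, ENNReal.toReal_ofReal (div_pos (hlp x) (hfp x)).le,
    Real.log_div (hlp x).ne' (hfp x).ne']

lemma integrable_likelihood_mul_logRatio_scaled (hS : S.Nonempty) (x : ℂ) (u c w : ℝ) :
    Integrable (fun y => likelihood x u ((c : ℂ) * y) * logRatio S x u ((c : ℂ) * y))
      (complexGaussian w) := by
  have hA : ∀ (_ : Unit) (y : ℂ), ‖(c : ℂ) * y‖ ≤ |c| * ‖y‖ := fun _ y => by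
    rw [norm_mul, Complex.norm_real, Real.norm_eq_abs]
  exact ((expBounded_likelihood x (fun _ => le_rfl) hA (abs_nonneg _)).mul
    (expBounded_logRatio hS x (fun _ => le_rfl) hA (abs_nonneg _))).integrable ()
    ((continuous_likelihood_mul_logRatio hS x u).comp (continuous_const_mul _)) _

lemma continuous_logRatio_uncurry (hS : S.Nonempty) (u c : ℝ) :
    Continuous fun p : ℂ × ℂ => logRatio S p.1 u ((c : ℂ) * p.2) :=
  (Continuous.log (f := fun p : ℂ × ℂ => likelihood p.1 u ((c : ℂ) * p.2)) (by fun_prop)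
    fun p => (likelihood_pos _ _ _).ne').sub
  (Continuous.log (f := fun p : ℂ × ℂ => mixture S u ((c : ℂ) * p.2)) (by fun_prop)
    fun p => (mixture_pos hS _ _).ne')

lemma integral_likelihood_mul_logRatio_prod (hS : S.Nonempty) {w : ℝ} (hw : 0 < w) :
    ∫ p, likelihood p.1 w⁻¹ ((w⁻¹ : ℝ) * p.2) * logRatio S p.1 w⁻¹ ((w⁻¹ : ℝ) * p.2)
      ∂((uniformOn (S : Set ℂ)).prod (complexGaussian w)) = gaussianInfo S w⁻¹ := by
  have hscale : (complexGaussian w).map (fun y => ((w⁻¹ : ℝ) : ℂ) * y) = complexGaussian w⁻¹ := by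
    rw [complexGaussian_map_mul _ hw.le]
    congr 1
    field_simp
  have hc : Continuous fun p : ℂ × ℂ =>
      likelihood p.1 w⁻¹ ((w⁻¹ : ℝ) * p.2) * logRatio S p.1 w⁻¹ ((w⁻¹ : ℝ) * p.2) :=
    Continuous.mul (by fun_prop) (continuous_logRatio_uncurry hS _ _)
  rw [integral_uniformOn_prod hc
    fun x _ => integrable_likelihood_mul_logRatio_scaled hS x _ _ _, gaussianInfo]
  congr 1
  refine Finset.sum_congr rfl fun x _ => ?_
  rw [← hscale]
  exact (integral_map (by fun_prop)
    (continuous_likelihood_mul_logRatio hS x w⁻¹).aestronglyMeasurable).symm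

/-- The mutual information of a uniform input and its output through an additive Gaussian
channel. -/
lemma mutualInfo_additive_channel (hS : S.Nonempty) {w : ℝ} (hw : 0 < w) :
    0 ≤ gaussianInfo S w⁻¹ ∧
    mutualInfo (((uniformOn (S : Set ℂ)).prod (complexGaussian w)).map
      (fun p => (p.1, p.1 + p.2))) =
        ENNReal.ofReal (gaussianInfo S w⁻¹) / ENNReal.ofReal (Real.log 2) := by
  have hprob := isProbabilityMeasure_uniformOn_finset hS
  have hlc : Continuous fun p : ℂ × ℂ => likelihood p.1 w⁻¹ ((w⁻¹ : ℝ) * p.2) := by fun_prop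
  have hFc : Continuous fun y : ℂ => mixture S w⁻¹ ((w⁻¹ : ℝ) * y) := by fun_prop
  have hlm : Measurable fun p : ℂ × ℂ =>
      ENNReal.ofReal (likelihood p.1 w⁻¹ ((w⁻¹ : ℝ) * p.2)) :=
    ENNReal.measurable_ofReal.comp hlc.measurable
  have hFm : Measurable fun y : ℂ => ENNReal.ofReal (mixture S w⁻¹ ((w⁻¹ : ℝ) * y)) :=
    ENNReal.measurable_ofReal.comp hFc.measurable
  have hmap : Measurable fun p : ℂ × ℂ => (p.1, p.1 + p.2) := by fun_prop
  have hρd := map_prodMk_add_eq_withDensity hw (uniformOn (S : Set ℂ))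
  have hfst : (((uniformOn (S : Set ℂ)).prod (complexGaussian w)).map
      (fun p => (p.1, p.1 + p.2))).map Prod.fst = uniformOn (S : Set ℂ) := by
    rw [Measure.map_map measurable_fst hmap]
    exact measurePreserving_fst.map_eq
  have hρprob : IsProbabilityMeasure (((uniformOn (S : Set ℂ)).prod (complexGaussian w)).map
      (fun p => (p.1, p.1 + p.2))) := Measure.isProbabilityMeasure_map hmap.aemeasurable
  -- From here only the density, the first marginal and the total mass of the joint law matter.
  generalize ((uniformOn (S : Set ℂ)).prod (complexGaussian w)).map
      (fun p => (p.1, p.1 + p.2)) = ρ at hρd hfst hρprob ⊢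
  have hsnd := map_snd_withDensity_likelihood hS (γ := complexGaussian w) (w⁻¹ : ℝ) w⁻¹
  rw [← hρd] at hsnd
  have : IsProbabilityMeasure (ρ.map Prod.fst) :=
    Measure.isProbabilityMeasure_map measurable_fst.aemeasurable
  have : IsProbabilityMeasure (ρ.map Prod.snd) :=
    Measure.isProbabilityMeasure_map measurable_snd.aemeasurable
  have hπd : (ρ.map Prod.fst).prod (ρ.map Prod.snd) =
      ((uniformOn (S : Set ℂ)).prod (complexGaussian w)).withDensity
        (fun p => ENNReal.ofReal (mixture S w⁻¹ ((w⁻¹ : ℝ) * p.2))) := by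
    rw [hfst, hsnd, prod_withDensity_right hFm]
  -- Joint law and product of marginals have densities `likelihood` and `mixture` against the same
  -- base, symbol times pure noise.
  obtain ⟨hac, hllr⟩ := llr_withDensity hlc.measurable (hFc.measurable.comp measurable_snd)
    (fun _ => likelihood_pos _ _ _) (fun _ => mixture_pos hS _ _) hρd hπd
  have hint : Integrable (fun p : ℂ × ℂ => logRatio S p.1 w⁻¹ ((w⁻¹ : ℝ) * p.2)) ρ := by
    rw [hρd, integrable_withDensity_iff_integrable_smul' hlm (ae_of_all _ fun _ =>
      ENNReal.ofReal_lt_top)]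
    simp_rw [ENNReal.toReal_ofReal (likelihood_pos _ _ _).le, smul_eq_mul]
    exact integrable_uniformOn_prod hS (hlc.mul (continuous_logRatio_uncurry hS _ _))
      fun x _ => integrable_likelihood_mul_logRatio_scaled hS x _ _ _
  have hval : ∫ p, llr ρ ((ρ.map Prod.fst).prod (ρ.map Prod.snd)) p ∂ρ =
      gaussianInfo S w⁻¹ := by
    rw [← integral_likelihood_mul_logRatio_prod hS hw, integral_congr_ae hllr]
    conv_lhs => rw [hρd]
    rw [integral_withDensity_eq_integral_toReal_smul hlm
      (ae_of_all _ fun _ => ENNReal.ofReal_lt_top)]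
    simp_rw [ENNReal.toReal_ofReal (likelihood_pos _ _ _).le, smul_eq_mul]
    rfl
  have hllri := hint.congr hllr.symm
  constructor
  -- Nonnegativity, which keeps `ENNReal.ofReal` from truncating later, is read off the divergence.
  · rw [← hval, ← InformationTheory.toReal_klDiv_of_measure_eq hac (by simp)]
    exact ENNReal.toReal_nonneg
  · rw [mutualInfo, InformationTheory.klDiv_of_ac_of_integrable hac hllri, hval]
    simp

/-- If the conditioning variable is independent of the pair, conditional mutual information is
mutual information. -/
lemma condMutualInfo_of_indep {Ω A B C : Type*} [MeasurableSpace Ω]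
    [MeasurableSpace A] [StandardBorelSpace A] [Nonempty A]
    [MeasurableSpace B] [StandardBorelSpace B] [Nonempty B] [MeasurableSpace C]
    {X : Ω → A} {Y : Ω → B} {Z : Ω → C} {μ : Measure Ω} [IsProbabilityMeasure μ]
    (hX : Measurable X) (hY : Measurable Y) (hZ : Measurable Z)
    (h : μ.map (fun ω => (Z ω, (X ω, Y ω))) =
      (μ.map Z).prod (μ.map fun ω => (X ω, Y ω))) :
    condMutualInfo X Y Z μ = mutualInfo (μ.map fun ω => (X ω, Y ω)) := by
  have : IsProbabilityMeasure (μ.map Z) := Measure.isProbabilityMeasure_map hZ.aemeasurable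
  have : IsProbabilityMeasure (μ.map fun ω => (X ω, Y ω)) :=
    Measure.isProbabilityMeasure_map (by fun_prop)
  have hc := condDistrib_ae_eq_of_measure_eq_compProd_of_measurable hZ (hX.prodMk hY)
    (μ := μ) (κ := Kernel.const C (μ.map fun ω => (X ω, Y ω))) (by rw [Measure.compProd_const, h])
  rw [condMutualInfo, lintegral_congr_ae (g := fun _ => mutualInfo (μ.map fun ω => (X ω, Y ω)))]
  · simp
  · filter_upwards [hc] with z hz
    rw [hz, Kernel.const_apply]

section channel

variable {S₁ S₂ : Finset ℂ} {P₁ P₂ W₁ W₂ : ℝ}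

/-- `I(aX; aX + N | bX')` when `(X', (X, N))` is a measurable function `T` of the channel
variables with independent components. -/
lemma condMutualInfo_of_measurePreserving {Ω : Type*} [MeasurableSpace Ω] {μ : Measure Ω}
    [IsProbabilityMeasure μ] (hS₁ : S₁.Nonempty) (hS₂ : S₂.Nonempty) (hP₁ : 0 < P₁) (hW₁ : 0 < W₁)
    {X N X' : Ω → ℂ} (c : ℂ)
    (hT : MeasurePreserving (fun ω => (X' ω, (X ω, N ω))) μ
      ((uniformOn (S₂ : Set ℂ)).prod ((uniformOn (S₁ : Set ℂ)).prod (complexGaussian W₁)))) :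
    0 ≤ gaussianInfo S₁ (P₁ / W₁) ∧
    condMutualInfo (fun ω => (√P₁ : ℂ) * X ω) (fun ω => (√P₁ : ℂ) * X ω + N ω)
      (fun ω => c * X' ω) μ =
        ENNReal.ofReal (gaussianInfo S₁ (P₁ / W₁)) / ENNReal.ofReal (Real.log 2) := by
  have h₁ := isProbabilityMeasure_uniformOn_finset hS₁
  have h₂ := isProbabilityMeasure_uniformOn_finset hS₂
  have hX' : Measurable X' := hT.measurable.fst
  have hX : Measurable X := hT.measurable.snd.fst
  have hN : Measurable N := hT.measurable.snd.snd
  have hs : √P₁ ≠ 0 := (Real.sqrt_pos.2 hP₁).ne'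
  have m1 : Measurable fun p : ℂ × ℂ => ((√P₁ : ℂ) * p.1, (√P₁ : ℂ) * p.1 + p.2) := by fun_prop
  have m2 : Measurable fun x : ℂ => c * x := by fun_prop
  have hjoint : μ.map (fun ω => (c * X' ω, ((√P₁ : ℂ) * X ω, (√P₁ : ℂ) * X ω + N ω))) =
      ((uniformOn (S₂ : Set ℂ)).map fun x => c * x).prod
        (((uniformOn (S₁ : Set ℂ)).prod (complexGaussian W₁)).map
          fun p => ((√P₁ : ℂ) * p.1, (√P₁ : ℂ) * p.1 + p.2)) := by
    rw [Measure.map_prod_map _ _ m2 m1, ← hT.map_eq, Measure.map_map (m2.prodMap m1) hT.measurable]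
    rfl
  have p1 : IsProbabilityMeasure ((uniformOn (S₂ : Set ℂ)).map fun x => c * x) :=
    Measure.isProbabilityMeasure_map m2.aemeasurable
  have p2 : IsProbabilityMeasure (((uniformOn (S₁ : Set ℂ)).prod (complexGaussian W₁)).map
      fun p => ((√P₁ : ℂ) * p.1, (√P₁ : ℂ) * p.1 + p.2)) :=
    Measure.isProbabilityMeasure_map m1.aemeasurable
  have hZ : μ.map (fun ω => c * X' ω) = (uniformOn (S₂ : Set ℂ)).map fun x => c * x := by
    have := congrArg (Measure.map Prod.fst) hjoint
    rw [Measure.map_map measurable_fst (by fun_prop), measurePreserving_fst.map_eq] at this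
    exact this
  have hXY : μ.map (fun ω => ((√P₁ : ℂ) * X ω, (√P₁ : ℂ) * X ω + N ω)) =
      ((uniformOn (S₁ : Set ℂ)).prod (complexGaussian W₁)).map
          fun p => ((√P₁ : ℂ) * p.1, (√P₁ : ℂ) * p.1 + p.2) := by
    have := congrArg (Measure.map Prod.snd) hjoint
    rw [Measure.map_map measurable_snd (by fun_prop), measurePreserving_snd.map_eq] at this
    exact this
  -- Sending √P₁ X is using the scaled constellation at unit power.
  have himage : ((uniformOn (S₁ : Set ℂ)).prod (complexGaussian W₁)).map
      (fun p => ((√P₁ : ℂ) * p.1, (√P₁ : ℂ) * p.1 + p.2)) =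
      ((uniformOn ((S₁.image fun x => (√P₁ : ℂ) * x : Finset ℂ) : Set ℂ)).prod
        (complexGaussian W₁)).map fun p => (p.1, p.1 + p.2) := by
    rw [← uniformOn_map_mul hs]
    conv_rhs => rw [← Measure.map_id (μ := complexGaussian W₁)]
    rw [Measure.map_prod_map _ _ (by fun_prop) measurable_id,
      Measure.map_map (by fun_prop) (by fun_prop)]
    rfl
  have hinfo : gaussianInfo (S₁.image fun x => (√P₁ : ℂ) * x) W₁⁻¹ =
      gaussianInfo S₁ (P₁ / W₁) := by
    rw [gaussianInfo_image_mul _ hs hS₁ (inv_nonneg.2 hW₁.le), Real.sq_sqrt hP₁.le, div_eq_mul_inv]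
  have key := mutualInfo_additive_channel (hS₁.image fun x => (√P₁ : ℂ) * x) hW₁
  rw [hinfo] at key
  rw [condMutualInfo_of_indep (by fun_prop) (by fun_prop) (by fun_prop)
    (by rw [hjoint, hZ, hXY]), hXY, himage]
  exact key

lemma isProbabilityMeasure_channelLaw (hS₁ : S₁.Nonempty) (hS₂ : S₂.Nonempty) (W₁ W₂ : ℝ) :
    IsProbabilityMeasure (channelLaw S₁ S₂ W₁ W₂) := by
  have h₁ := isProbabilityMeasure_uniformOn_finset hS₁
  have h₂ := isProbabilityMeasure_uniformOn_finset hS₂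
  unfold channelLaw
  infer_instance

lemma condMutualInfo_user₁ (hS₁ : S₁.Nonempty) (hS₂ : S₂.Nonempty) (hP₁ : 0 < P₁)
    (hW₁ : 0 < W₁) :
    0 ≤ gaussianInfo S₁ (P₁ / W₁) ∧
    condMutualInfo (sent₁ P₁) (received₁ P₁) (sent₂ P₂) (channelLaw S₁ S₂ W₁ W₂) =
      ENNReal.ofReal (gaussianInfo S₁ (P₁ / W₁)) / ENNReal.ofReal (Real.log 2) := by
  have := isProbabilityMeasure_channelLaw hS₁ hS₂ W₁ W₂
  have h1 : MeasurePreserving (fun ω : ℂ × ℂ × ℂ × ℂ => (ω.1, (ω.2.1, ω.2.2.1)))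
      (channelLaw S₁ S₂ W₁ W₂)
      ((uniformOn (S₁ : Set ℂ)).prod ((uniformOn (S₂ : Set ℂ)).prod (complexGaussian W₁))) :=
    (MeasurePreserving.id _).prod ((MeasurePreserving.id _).prod measurePreserving_fst)
  have h2 : MeasurePreserving (fun p : ℂ × ℂ × ℂ => (p.2.1, (p.1, p.2.2)))
      ((uniformOn (S₁ : Set ℂ)).prod ((uniformOn (S₂ : Set ℂ)).prod (complexGaussian W₁)))
      ((uniformOn (S₂ : Set ℂ)).prod ((uniformOn (S₁ : Set ℂ)).prod (complexGaussian W₁))) :=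
    (measurePreserving_prodAssoc _ _ _).comp
      ((Measure.measurePreserving_swap.prod (MeasurePreserving.id _)).comp
        (measurePreserving_prodAssoc _ _ _).symm)
  exact condMutualInfo_of_measurePreserving hS₁ hS₂ hP₁ hW₁ _ (h2.comp h1)

lemma condMutualInfo_user₂ (hS₁ : S₁.Nonempty) (hS₂ : S₂.Nonempty) (hP₂ : 0 < P₂)
    (hW₂ : 0 < W₂) :
    0 ≤ gaussianInfo S₂ (P₂ / W₂) ∧
    condMutualInfo (sent₂ P₂) (received₂ P₂) (sent₁ P₁) (channelLaw S₁ S₂ W₁ W₂) =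
      ENNReal.ofReal (gaussianInfo S₂ (P₂ / W₂)) / ENNReal.ofReal (Real.log 2) := by
  have := isProbabilityMeasure_channelLaw hS₁ hS₂ W₁ W₂
  have h : MeasurePreserving (fun ω : ℂ × ℂ × ℂ × ℂ => (ω.1, (ω.2.1, ω.2.2.2)))
      (channelLaw S₁ S₂ W₁ W₂)
      ((uniformOn (S₁ : Set ℂ)).prod ((uniformOn (S₂ : Set ℂ)).prod (complexGaussian W₂))) :=
    (MeasurePreserving.id _).prod ((MeasurePreserving.id _).prod measurePreserving_snd)
  exact condMutualInfo_of_measurePreserving hS₂ hS₁ hP₂ hW₂ _ h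

end channel

end FDMA

end

-- Optimizing the bandwidth split

noncomputable section

namespace FDMA

variable {S : Finset ℂ} {P₁ P₂ W α : ℝ}

/-- The weighted sum of the two users' rates, in nats. -/
def natRate (S : Finset ℂ) (P₁ P₂ W α : ℝ) : ℝ :=
  α * W * gaussianInfo S (P₁ / (α * W)) + (1 - α) * W * gaussianInfo S (P₂ / ((1 - α) * W))

lemma sumRate_eq (hS : S.Nonempty) (hP₁ : 0 < P₁) (hP₂ : 0 < P₂) (hW : 0 < W)
    (hα : α ∈ Set.Ioo (0 : ℝ) 1) :
    0 ≤ natRate S P₁ P₂ W α ∧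
    sumRate S S P₁ P₂ W α =
      ENNReal.ofReal (natRate S P₁ P₂ W α) / ENNReal.ofReal (Real.log 2) := by
  have hW₁ : 0 < α * W := mul_pos hα.1 hW
  have hW₂ : 0 < (1 - α) * W := mul_pos (sub_pos.2 hα.2) hW
  obtain ⟨n1, e1⟩ := condMutualInfo_user₁ (P₂ := P₂) (W₂ := (1 - α) * W) hS hS hP₁ hW₁
  obtain ⟨n2, e2⟩ := condMutualInfo_user₂ (P₁ := P₁) (W₁ := α * W) hS hS hP₂ hW₂
  have m1 := mul_nonneg hW₁.le n1
  have m2 := mul_nonneg hW₂.le n2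
  refine ⟨add_nonneg m1 m2, ?_⟩
  rw [sumRate, e1, e2, natRate, ENNReal.ofReal_add m1 m2, ENNReal.ofReal_mul hW₁.le,
    ENNReal.ofReal_mul hW₂.le, ENNReal.add_div, mul_div_assoc, mul_div_assoc]

lemma natRate_proportional (hP₁ : 0 < P₁) (hP₂ : 0 < P₂) (hW : 0 < W) :
    natRate S P₁ P₂ W (P₁ / (P₁ + P₂)) = W * gaussianInfo S ((P₁ + P₂) / W) := by
  have h1 : P₁ / (P₁ / (P₁ + P₂) * W) = (P₁ + P₂) / W := by field_simp
  have h2 : 1 - P₁ / (P₁ + P₂) = P₂ / (P₁ + P₂) := by field_simp; ring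
  have h3 : P₂ / (P₂ / (P₁ + P₂) * W) = (P₁ + P₂) / W := by field_simp
  rw [natRate, h1, h2, h3]
  field_simp

/-- Strict Jensen: the weighted mean of the two ratios does not depend on α, and they coincide only
at the proportional split. -/
lemma natRate_lt (hS : S.Nontrivial) (hP₁ : 0 < P₁) (hP₂ : 0 < P₂) (hW : 0 < W)
    (hα : α ∈ Set.Ioo (0 : ℝ) 1) (hne : α ≠ P₁ / (P₁ + P₂)) :
    natRate S P₁ P₂ W α < natRate S P₁ P₂ W (P₁ / (P₁ + P₂)) := by
  have hα1 : 0 < 1 - α := sub_pos.2 hα.2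
  have hα0 := hα.1
  have hs : P₁ / (α * W) ≠ P₂ / ((1 - α) * W) := by
    intro h
    apply hne
    rw [div_eq_div_iff (by positivity) (by positivity)] at h
    rw [eq_div_iff (by positivity)]
    have : W * (P₁ * (1 - α) - P₂ * α) = 0 := by linarith
    rcases mul_eq_zero.1 this with h | h <;> linarith
  have h := (strictConcaveOn_gaussianInfo hS).2 (Set.mem_Ioi.2 (by positivity : 0 < P₁ / (α * W)))
    (Set.mem_Ioi.2 (by positivity : 0 < P₂ / ((1 - α) * W))) hs hα0 hα1 (by ring)
  have e : α • (P₁ / (α * W)) + (1 - α) • (P₂ / ((1 - α) * W)) = (P₁ + P₂) / W := by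
    simp only [smul_eq_mul]
    field_simp
  rw [e] at h
  rw [natRate_proportional hP₁ hP₂ hW, natRate]
  simp only [smul_eq_mul] at h
  have := mul_lt_mul_of_pos_left h hW
  linarith

lemma natRate_le (hS : S.Nonempty) (hP₁ : 0 < P₁) (hP₂ : 0 < P₂) (hW : 0 < W)
    (hα : α ∈ Set.Ioo (0 : ℝ) 1) :
    natRate S P₁ P₂ W α ≤ natRate S P₁ P₂ W (P₁ / (P₁ + P₂)) := by
  rcases hS.exists_eq_singleton_or_nontrivial with ⟨x, rfl⟩ | hS
  · simp [natRate, gaussianInfo_singleton]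
  · by_cases h : α = P₁ / (P₁ + P₂)
    · rw [h]
    · exact (natRate_lt hS hP₁ hP₂ hW hα h).le

end FDMA

end

theorem theorem2 (S₁ S₂ : Finset ℂ) (hS : S₁ = S₂) (hne : S₁.Nonempty)
    (P₁ P₂ W : ℝ) (hP₁ : 0 < P₁) (hP₂ : 0 < P₂) (hW : 0 < W) :
    P₁ / (P₁ + P₂) ∈ Set.Ioo (0 : ℝ) 1 ∧
      FDMA.sumRate S₁ S₂ P₁ P₂ W (P₁ / (P₁ + P₂)) < ∞ ∧
      IsMaxOn (FDMA.sumRate S₁ S₂ P₁ P₂ W) (Set.Ioo 0 1) (P₁ / (P₁ + P₂)) ∧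
      (S₁.Nontrivial → ∀ α ∈ Set.Ioo (0 : ℝ) 1,
        IsMaxOn (FDMA.sumRate S₁ S₂ P₁ P₂ W) (Set.Ioo 0 1) α → α = P₁ / (P₁ + P₂)) := by
  subst hS
  have hmem : P₁ / (P₁ + P₂) ∈ Set.Ioo (0 : ℝ) 1 :=
    ⟨by positivity, by rw [div_lt_one (by positivity)]; linarith⟩
  have hlog : ENNReal.ofReal (Real.log 2) ≠ 0 := by simpa using Real.log_pos one_lt_two
  obtain ⟨h0, he⟩ := FDMA.sumRate_eq hne hP₁ hP₂ hW hmem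
  refine ⟨hmem, ?_, fun α hα => ?_, fun hnt α hα hmax => ?_⟩
  · rw [he]
    exact ENNReal.div_lt_top ENNReal.ofReal_ne_top hlog
  · simp only [Set.mem_ofPred_eq]
    rw [he, (FDMA.sumRate_eq hne hP₁ hP₂ hW hα).2]
    exact ENNReal.div_le_div_right
      (ENNReal.ofReal_le_ofReal (FDMA.natRate_le hne hP₁ hP₂ hW hα)) _
  · by_contra hcon
    have hlt := FDMA.natRate_lt hnt hP₁ hP₂ hW hα hcon
    have hle := hmax hmem
    simp only [Set.mem_ofPred_eq] at hle
    obtain ⟨hα0, hαe⟩ := FDMA.sumRate_eq hne hP₁ hP₂ hW hα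
    have hl : 0 < Real.log 2 := Real.log_pos one_lt_two
    -- Passing from extended to real rates uses that the rate at α is nonnegative.
    rw [he, hαe, ← ENNReal.ofReal_div_of_pos hl, ← ENNReal.ofReal_div_of_pos hl,
      ENNReal.ofReal_le_ofReal_iff (div_nonneg hα0 hl.le), div_le_div_iff_of_pos_right hl] at hle
    exact absurd hle (not_le.2 hlt)
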